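/- Let $R\in(0,\infty)\setminus\{1\}$, $b_1>0$, $b_2>1$, $b_3>0$. Put $$m(q)=\frac{R(1-R)}{b_1}q^2-\frac{b_3(1-R)}{b_1}q+1,\qquad \ell(q)=m(q)+\frac{1-R}{b_1}q(1-q)+\frac{(b_2-1)R(1-R)}{b_1}\,\frac{q}{(1-R)q+R},$$ $q_M=\frac{b_3}{2R}$, $m_M=m(q_M)$, $\varphi(q,n)=b_1(n-1)+(1-R)(b_3-2R)q+(2-b_2)R(1-R)$, $E(q)^2=4R^2(1-R)^2(b_2-1)(1-q)^2$, and $$O(q,n)=\frac{(1-R)n}{R(1-q)}-\frac{2(1-R)^2qn/R}{2(1-R)(1-q)[(1-R)q+R]-\varphi(q,n)-\operatorname{sgn}(1-R)\sqrt{\varphi(q,n)^2+E(q)^2}},$$ extended by continuity to the points $(1,n)$ with $(1-R)n<(1-R)\ell(1)$. Let $F(q,n)=O(q,n)/n$, extended by continuity to $n=0$. Only points $q>0$, $n\ge 0$ are considered at which $(1-R)n<(1-R)\ell(q)$ if $q\le 1$, and at which the denominator of the second term of $O$ is nonzero if $q\neq 1$. For $u>0$ let $n_u$ denote the solution, for $q\ge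 u$, of $n'(q)=O(q,n(q))$, $n(u)=m(u)$, through such points. Let $$\zeta(u)=\inf\{q\ge u:(1-R)n_u(q)<(1-R)m(q)\},\qquad \Sigma(u)=\exp\Big(-\int_u^{\zeta(u)}\frac{R}{q(1-R)}F(q,n_u(q))\,dq\Big)-1 .$$ (i) Suppose $m_M>0$. Then for every $u\in(0,q_M]$ the solution $n_u$ is unique and exists beyond $\zeta(u)<\infty$, and the integral exists. The map $\Sigma$ is a strictly decreasing continuous bijection $(0,q_M]\to[0,\infty)$ with $\Sigma(0+)=+\infty$ and $\Sigma(q_M)=0$. (ii) Suppose $m_M\le 0$ and $\ell(1)>0$. Then $m$ has two real roots $0<p_-\le p_+$ (equal if $m_M=0$), the integral in $$\overline\xi:=\exp\Big(-\int_{p_-}^{p_+}\frac{R}{q(1-R)}F(q,0)\,dq\Big)-1$$ exists, and $\lim_{u\uparrow p_-}\Sigma(u)=\overline\xi$. For every $u\in(0,p_-]$ the solution $n_u$ is unique and exists beyond $\zeta(u)<\infty$, and the integral in $\Sigma(u)$ exists. The map $\Sigma$ is a strictly decreasing continuous bijection $(0,p_-]\to[\overline\xi,\infty)$ with $\Sigma(0+)=+\infty$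 and $\Sigma(p_-)=\overline\xi$. Moreover, as $u\uparrow p_-$, $\zeta(u)\to p_+$ and $n_u\to 0$ uniformly on bounded sets: for all $K$ and $\varepsilon>0$, if $u<p_-$ is close enough to $p_-$, then $n_u$ exists on $[u,K]$ and $|n_u|<\varepsilon$ there. -/

import Mathlib

open Set Filter Topology

noncomputable section

namespace RoundTrip

/-- The auxiliary parameters of the problem: the risk aversion `R` and the constants
`b₁`, `b₂`, `b₃`. The standing assumptions on them are hypotheses of the theorem. -/
structure Params where
  R : ℝ
  b₁ : ℝ
  b₂ : ℝ
  b₃ : ℝ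

variable (P : Params)

/-- The quadratic `m(q)`. -/
def m (q : ℝ) : ℝ :=
  P.R * (1 - P.R) / P.b₁ * q ^ 2 - P.b₃ * (1 - P.R) / P.b₁ * q + 1

/-- The algebraic function `ℓ(q)`. -/
def ell (q : ℝ) : ℝ :=
  m P q + (1 - P.R) / P.b₁ * q * (1 - q)
    + (P.b₂ - 1) * P.R * (1 - P.R) / P.b₁ * (q / ((1 - P.R) * q + P.R))

/-- The turning point `q_M` of `m`. -/
def qM : ℝ := P.b₃ / (2 * P.R)

/-- The extreme value `m_M = m(q_M)` of `m`. -/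
def mM : ℝ := m P (qM P)

def phi (q n : ℝ) : ℝ :=
  P.b₁ * (n - 1) + (1 - P.R) * (P.b₃ - 2 * P.R) * q + (2 - P.b₂) * P.R * (1 - P.R)

/-- The function `E(q)²`. -/
def Esq (q : ℝ) : ℝ := 4 * P.R ^ 2 * (1 - P.R) ^ 2 * (P.b₂ - 1) * (1 - q) ^ 2

/-- The denominator of the second term in the formula for `O(q,n)`. -/
def den (q n : ℝ) : ℝ :=
  2 * (1 - P.R) * (1 - q) * ((1 - P.R) * q + P.R) - phi P q n
    - Real.sign (1 - P.R) * √(phi P q n ^ 2 + Esq P q)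

/-- The formula for `O(q,n)`, meaningful where `q ≠ 1` and `den P q n ≠ 0`. -/
def Oraw (q n : ℝ) : ℝ :=
  (1 - P.R) * n / (P.R * (1 - q)) - (2 * (1 - P.R) ^ 2 * q * n / P.R) / den P q n

open Classical in
/-- `O(q,n)`, extended to `q = 1` by continuity. -/
def O (q n : ℝ) : ℝ :=
  if q = 1 then limUnder (𝓝[≠] (1 : ℝ)) (fun x => Oraw P x n) else Oraw P q n

open Classical in
/-- `F(q,n) = O(q,n)/n`, extended to `n = 0` by continuity. -/
def F (q n : ℝ) : ℝ :=
  if n = 0 then limUnder (𝓝[>] (0 : ℝ)) (fun k => O P q k / k) else O P q n / n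

/-- The points of `(0,∞) × [0,∞)` at which `O` and `F` are defined (possibly as limits).
To the left of `q = 1`, and at `q = 1`, these are points with `(1-R) n < (1-R) ℓ(q)`;
away from `q = 1` the denominator in the formula for `O` must not vanish. At `q = R/(R-1)`
when `R > 1`, and at `n = ℓ(q)` for `q > 1` when `(1-R)q + R > 0`, this denominator
is nonzero, so that the formula itself gives the value of the continuous extension. -/
def Regular (q n : ℝ) : Prop :=
  0 < q ∧ 0 ≤ n ∧ (q ≤ 1 → (1 - P.R) * n < (1 - P.R) * ell P q) ∧ (q ≠ 1 → den P q n ≠ 0)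

/-- `f` solves `n'(q) = O(q, n(q))` on `[u,z]` with `n(u) = m(u)`, staying in the region where
`O` is defined. -/
def IsSolution (u z : ℝ) (f : ℝ → ℝ) : Prop :=
  f u = m P u ∧
    ∀ q ∈ Icc u z, Regular P q (f q) ∧ HasDerivWithinAt f (O P q (f q)) (Icc u z) q

/-- The interval of existence: all `q ≥ u` such that the initial value problem started from
`(u, m(u))` has a solution on `[u,q]`. -/
def existenceSet (u : ℝ) : Set ℝ := {q | u ≤ q ∧ ∃ f, IsSolution P u q f}

open Classical in
/-- The solution `n_u(q)` of the initial value problem, as a function of `q` in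
`existenceSet P u` (and `0`, without meaning, elsewhere). -/
def nSol (u q : ℝ) : ℝ :=
  if h : ∃ f, IsSolution P u q f then h.choose q else 0

/-- The points at which `n_u` has crossed `m`. -/
def crossingSet (u : ℝ) : Set ℝ :=
  {q | q ∈ existenceSet P u ∧ (1 - P.R) * nSol P u q < (1 - P.R) * m P q}

/-- `ζ(u)`, where `n_u` first crosses `m` to the right of `u`. -/
def zeta (u : ℝ) : ℝ := sInf (crossingSet P u)

/-- The integrand in the definition of the round-trip cost, along a function `f`. -/
def integrand (f : ℝ → ℝ) (q : ℝ) : ℝ := -(P.R / (q * (1 - P.R))) * F P q (f q)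

/-- The round-trip transaction cost `Σ(u)`. -/
def Sig (u : ℝ) : ℝ := Real.exp (∫ q in u..zeta P u, integrand P (nSol P u) q) - 1

/-- The critical cost `ξ̄`, for the roots `pm ≤ pp` of `m`. -/
def xiBar (pm pp : ℝ) : ℝ := Real.exp (∫ q in pm..pp, integrand P (fun _ => 0) q) - 1

/-- All objects entering `Σ(u)` are genuinely defined: `n_u` is the unique solution of the
initial value problem and exists to the right of `ζ(u)`, it does cross `m`
(so that `ζ(u) < ∞`), and the integral in `Σ(u)` exists. -/
structure WellDefinedAt (u : ℝ) : Prop where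
  unique : ∀ z f, IsSolution P u z f → EqOn f (nSol P u) (Icc u z)
  crosses : (crossingSet P u).Nonempty
  exists_beyond : ∃ z, zeta P u < z ∧ IsSolution P u z (nSol P u)
  integrable : IntervalIntegrable (integrand P (nSol P u)) MeasureTheory.volume u (zeta P u)

end RoundTrip

end

noncomputable section

namespace RoundTrip

/-! Put `y = sgn(1-R) n`, `M = sgn(1-R) m`, `L = sgn(1-R) ℓ`. For either sign of `1-R`, `M` is then
an upward parabola with vertex `q_M`. Rationalising the square root in `O` introduces the positive
root `p` of `(p-1)((1-q)²p + b₂-1) = c (y-M) p`. With `D = q - R(1-q)(p-1)` the factor `1-q`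
cancels, leaving `F = -(1-R)(p-1)/D` and the cost integrand `(R/q)(p-1)/D` (`Oraw_eq`, `O_eq`,
`F_eq`). Hence the singularities at `q = 1` and `n = 0` are removable, solutions are unique, and the
sign of `p-1` is that of `y-M` (`one_le_rt_iff`). Where `D > 0`, `y` therefore decreases above `M`
and increases below it.

Since `M` falls up to `q_M` and rises afterwards, a solution started on `M` at `u` stays above `M`
until `q_M`. It must meet `M` by the mirror point `2q_M - u`, because `y` has decreased while `M`
has returned to its initial value; after that it stays below (`exists_crossing`). To the left of `1`
it cannot reach `L`, where `D` vanishes, because the downward drift blows up there (`drift_ge`,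
`le_sl`). That argument needs `n` bounded away from `0` near `L`: for `R < 1` this follows from
`ℓ(1) > 0`, for `R > 1` from `n ≥ 1`.

To have existence and uniform estimates at once, the field is cut off to a bounded Lipschitz one on
a fixed interval `[u₁, T]`. The cut-off is inactive on the relevant trajectories up to slightly
beyond the crossing. The cost is cut off at `p = 1`, so it vanishes below `M`, and the moving
endpoint `ζ(u)` can be replaced by `T` (`summary`). An earlier start then gives a larger solution
and a larger cost, so `Σ` is strictly decreasing. Gronwall makes the integral Lipschitz in `u`, so
`Σ` is continuous. A logarithmic lower bound gives `Σ(0+) = ∞` (`exists_log_le`), and the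
intermediate value theorem gives the bijection.

If `m_M ≤ 0`, then `m(0) = 1` forces `R < 1`, and the solution from the smaller root is identically
zero up to the larger one. This identifies the limiting cost, and Gronwall against the zero solution
gives the uniform convergence. -/

/-- The standing assumptions, together with `0 < ℓ(1)` when `R < 1`. -/
structure Good (P : Params) : Prop where
  R_pos : 0 < P.R
  R_ne : P.R ≠ 1
  b₁_pos : 0 < P.b₁
  b₂_gt : 1 < P.b₂
  b₃_pos : 0 < P.b₃
  ell_pos : P.R < 1 → 0 < ell P 1

/-! ### Sign normalisation and the root `p`. -/

variable (P : Params)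

/-- The sign of `1 - R`. -/
def sg : ℝ := Real.sign (1 - P.R)

/-- The modulus of `1 - R`. -/
def ra : ℝ := |1 - P.R|

/-- The constant `b₁ / (|1 - R| R)` by which the deviation `y - M(q)` enters. -/
def cc : ℝ := P.b₁ / (ra P * P.R)

/-- `sgn(1-R) m(q)`. -/
def sm (q : ℝ) : ℝ := ra P / P.b₁ * (P.R * q ^ 2 - P.b₃ * q) + sg P

/-- The linear function `(1-R) q + R`. -/
def lin (q : ℝ) : ℝ := (1 - P.R) * q + P.R

/-- `sgn(1-R) ℓ(q)`. -/
def sl (q : ℝ) : ℝ :=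
  sm P q + ra P / P.b₁ * (q * (1 - q) + (P.b₂ - 1) * P.R * (q / lin P q))

/-- The normalized function `sgn(1-R) φ / (|1-R| R)` in the variable `y = sgn(1-R) n`. -/
def nphi (q y : ℝ) : ℝ := (1 - q) ^ 2 - (P.b₂ - 1) + cc P * (y - sm P q)

/-- The normalized function `√(φ² + E²) - sgn(1-R) φ`. -/
def nrt (q y : ℝ) : ℝ :=
  √(nphi P q y ^ 2 + 4 * (P.b₂ - 1) * (1 - q) ^ 2) - nphi P q y

/-- The positive root `p` of `(p - 1) ((1 - q)² p + b₂ - 1) = c (y - M(q)) p`. -/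
def rt (q y : ℝ) : ℝ := 2 * (P.b₂ - 1) / nrt P q y

/-- The normalized denominator as a function of `q` and `p`. -/
def dn (q p : ℝ) : ℝ := q - P.R * (1 - q) * (p - 1)

variable {P}

namespace Good

theorem ra_pos (h : Good P) : 0 < ra P := abs_pos.2 (sub_ne_zero.2 h.R_ne.symm)

theorem sg_mul_ra (_h : Good P) : sg P * ra P = 1 - P.R := by
  unfold sg ra
  rcases lt_trichotomy (1 - P.R) 0 with h | h | h
  · rw [Real.sign_of_neg h, abs_of_neg h]; ring
  · rw [h]; simp
  · rw [Real.sign_of_pos h, abs_of_pos h]; ring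

theorem sg_cases (h : Good P) : (P.R < 1 ∧ sg P = 1 ∧ ra P = 1 - P.R) ∨
    (1 < P.R ∧ sg P = -1 ∧ ra P = P.R - 1) := by
  rcases lt_or_gt_of_ne h.R_ne with h' | h'
  · exact Or.inl ⟨h', Real.sign_of_pos (by linarith), abs_of_pos (by linarith)⟩
  · refine Or.inr ⟨h', Real.sign_of_neg (by linarith), ?_⟩
    unfold ra; rw [abs_of_neg (by linarith)]; ring

theorem sg_sq (h : Good P) : sg P * sg P = 1 := by
  rcases h.sg_cases with ⟨-, h, -⟩ | ⟨-, h, -⟩ <;> rw [h] <;> norm_num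

theorem be_pos (h : Good P) : 0 < P.b₂ - 1 := by linarith [h.b₂_gt]

theorem cc_pos (h : Good P) : 0 < cc P :=
  div_pos h.b₁_pos (mul_pos h.ra_pos h.R_pos)

theorem sm_eq (h : Good P) (q : ℝ) : sm P q = sg P * m P q := by
  have := h.b₁_pos.ne'
  rcases h.sg_cases with ⟨-, h1, h2⟩ | ⟨-, h1, h2⟩ <;> unfold sm m <;> rw [h1, h2] <;>
    field_simp <;> ring

theorem sl_eq (h : Good P) (q : ℝ) : sl P q = sg P * ell P q := by
  unfold sl ell
  rw [h.sm_eq]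
  have := h.b₁_pos.ne'
  change _ = sg P * (m P q + (1 - P.R) / P.b₁ * q * (1 - q)
    + (P.b₂ - 1) * P.R * (1 - P.R) / P.b₁ * (q / lin P q))
  generalize q / lin P q = t
  rcases h.sg_cases with ⟨-, h1, h2⟩ | ⟨-, h1, h2⟩ <;> rw [h1, h2] <;>
    field_simp <;> ring

theorem mul_lt_mul_iff_sg (h : Good P) (x y : ℝ) :
    (1 - P.R) * x < (1 - P.R) * y ↔ sg P * x < sg P * y := by
  rw [← h.sg_mul_ra, mul_comm (sg P), mul_assoc, mul_assoc]
  exact mul_lt_mul_iff_right₀ h.ra_pos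

theorem sg_sg (h : Good P) (x : ℝ) : sg P * (sg P * x) = x := by
  rw [← mul_assoc, h.sg_sq, one_mul]

theorem phi_eq (h : Good P) (q y : ℝ) :
    phi P q (sg P * y) = sg P * (ra P * P.R) * nphi P q y := by
  have := h.b₁_pos.ne'
  have := h.R_pos.ne'
  have := h.ra_pos.ne'
  unfold phi nphi sm cc
  rcases h.sg_cases with ⟨-, h1, h2⟩ | ⟨-, h1, h2⟩ <;> rw [h1] <;> field_simp <;> rw [h2] <;> ring

theorem sqrt_eq (h : Good P) (q y : ℝ) :
    √(phi P q (sg P * y) ^ 2 + Esq P q) =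
      ra P * P.R * √(nphi P q y ^ 2 + 4 * (P.b₂ - 1) * (1 - q) ^ 2) := by
  have hk : 0 ≤ ra P * P.R := (mul_pos h.ra_pos h.R_pos).le
  rw [h.phi_eq]
  have : (sg P * (ra P * P.R) * nphi P q y) ^ 2 + Esq P q =
      (ra P * P.R) ^ 2 * (nphi P q y ^ 2 + 4 * (P.b₂ - 1) * (1 - q) ^ 2) := by
    have h1 := h.sg_sq
    have h2 : (1 - P.R) ^ 2 = ra P ^ 2 := (sq_abs _).symm
    unfold Esq
    rw [h2]
    linear_combination (ra P * P.R) ^ 2 * nphi P q y ^ 2 * h1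
  rw [this, Real.sqrt_mul (sq_nonneg _), Real.sqrt_sq hk]

theorem nrt_pos_of_ne (h : Good P) {q : ℝ} (hq : q ≠ 1) (y : ℝ) : 0 < nrt P q y := by
  unfold nrt
  have h1 : |nphi P q y| < √(nphi P q y ^ 2 + 4 * (P.b₂ - 1) * (1 - q) ^ 2) := by
    apply Real.lt_sqrt_of_sq_lt
    rw [sq_abs]
    have : 0 < (1 - q) ^ 2 := by
      have : 1 - q ≠ 0 := sub_ne_zero.2 hq.symm
      positivity
    have := mul_pos h.be_pos this
    linarith
  linarith [le_abs_self (nphi P q y)]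

theorem nrt_pos_of_neg (_h : Good P) {q y : ℝ} (hy : nphi P q y < 0) : 0 < nrt P q y := by
  unfold nrt
  linarith [Real.sqrt_nonneg (nphi P q y ^ 2 + 4 * (P.b₂ - 1) * (1 - q) ^ 2)]

theorem rt_pos (h : Good P) {q y : ℝ} (hy : 0 < nrt P q y) : 0 < rt P q y :=
  div_pos (mul_pos two_pos h.be_pos) hy

/-- With `t = nphi` and `b = b₂ - 1`, the number `w = nrt` satisfies `w² + 2tw = 4b(1-q)²`.
Substituting `w = 2b/p` gives `b + tp = (1-q)²p²`, which rearranges to the claim because `c(y-M) = t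
- (1-q)² + b`. -/
theorem rt_eq (h : Good P) {q y : ℝ} (hy : 0 < nrt P q y) :
    (rt P q y - 1) * ((1 - q) ^ 2 * rt P q y + (P.b₂ - 1)) =
      cc P * (y - sm P q) * rt P q y := by
  have hb := h.be_pos
  have hs : (nrt P q y + nphi P q y) ^ 2 =
      nphi P q y ^ 2 + 4 * (P.b₂ - 1) * (1 - q) ^ 2 := by
    unfold nrt
    rw [sub_add_cancel, Real.sq_sqrt]
    have := mul_nonneg hb.le (sq_nonneg (1 - q))
    nlinarith [sq_nonneg (nphi P q y)]
  have ht : nphi P q y = (1 - q) ^ 2 - (P.b₂ - 1) + cc P * (y - sm P q) := rfl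
  have hw : rt P q y * nrt P q y = 2 * (P.b₂ - 1) := div_mul_cancel₀ _ hy.ne'
  generalize rt P q y = p at *
  generalize nrt P q y = w at *
  generalize nphi P q y = t at *
  generalize cc P * (y - sm P q) = d at *
  have hb' : P.b₂ - 1 ≠ 0 := hb.ne'
  generalize P.b₂ - 1 = b at *
  have h3 : w * (w + 2 * t) = 4 * b * (1 - q) ^ 2 := by linear_combination hs
  have hd : d = t - (1 - q) ^ 2 + b := by linear_combination -ht
  subst hd
  have : b * ((p - 1) * ((1 - q) ^ 2 * p + b) - (t - (1 - q) ^ 2 + b) * p) = 0 := by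
    have e1 : (1 - q) ^ 2 * p ^ 2 * (4 * b) = p ^ 2 * (w * (w + 2 * t)) := by
      linear_combination -p ^ 2 * h3
    linear_combination e1 / 4 + (p * w + 2 * b + 2 * t * p) * hw / 4
  rcases mul_eq_zero.1 this with h | h
  · exact absurd h hb'
  · linarith

/-- In `rt_eq` the factors multiplying `p - 1` and `y - M` are both positive, so these two
differences have the same sign. This fixes the sign of the field and of the cost. -/
theorem one_le_rt_iff (h : Good P) {q y : ℝ} (hy : 0 < nrt P q y) :
    1 ≤ rt P q y ↔ sm P q ≤ y := by
  have hp := h.rt_pos hy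
  have he := h.rt_eq hy
  have h1 : 0 < (1 - q) ^ 2 * rt P q y + (P.b₂ - 1) := by have := h.be_pos; positivity
  have h2 : 0 < cc P * rt P q y := mul_pos h.cc_pos hp
  constructor <;> intro h3 <;> by_contra! h4
  · nlinarith [mul_nonneg (sub_nonneg.2 h3) h1.le, mul_pos h2 (sub_pos.2 h4)]
  · nlinarith [mul_nonneg (sub_nonneg.2 h3) h2.le, mul_pos h1 (sub_pos.2 h4)]

theorem rt_le_one_iff (h : Good P) {q y : ℝ} (hy : 0 < nrt P q y) :
    rt P q y ≤ 1 ↔ y ≤ sm P q := by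
  have hp := h.rt_pos hy
  have he := h.rt_eq hy
  have h1 : 0 < (1 - q) ^ 2 * rt P q y + (P.b₂ - 1) := by have := h.be_pos; positivity
  have h2 : 0 < cc P * rt P q y := mul_pos h.cc_pos hp
  constructor <;> intro h3 <;> by_contra! h4
  · nlinarith [mul_nonneg (sub_nonneg.2 h3) h1.le, mul_pos h2 (sub_pos.2 h4)]
  · nlinarith [mul_nonneg (sub_nonneg.2 h3) h2.le, mul_pos h1 (sub_pos.2 h4)]

/-- The relation between the denominator and the distance to `ℓ`. -/
theorem cc_mul_sl_sub (h : Good P) {q y : ℝ} (hy : 0 < nrt P q y) (hA : lin P q ≠ 0) :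
    cc P * (sl P q - y) =
      dn P q (rt P q y) * ((1 - q) / P.R + (P.b₂ - 1) / (rt P q y * lin P q)) := by
  have hp := (h.rt_pos hy).ne'
  have he := h.rt_eq hy
  have h1 : cc P * (sl P q - sm P q) =
      q * ((1 - q) / P.R + (P.b₂ - 1) / lin P q) := by
    have := h.b₁_pos.ne'
    have := h.R_pos.ne'
    have := h.ra_pos.ne'
    unfold sl cc
    rw [add_sub_cancel_left]
    field_simp
  have h2 : cc P * (sl P q - y) = q * ((1 - q) / P.R + (P.b₂ - 1) / lin P q)
      - cc P * (y - sm P q) := by linear_combination h1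
  have h3 : cc P * (y - sm P q) =
      (rt P q y - 1) * ((1 - q) ^ 2 * rt P q y + (P.b₂ - 1)) / rt P q y := by
    rw [eq_div_iff hp, he]
  have hlin : q = lin P q - P.R * (1 - q) := by unfold lin; ring
  have hdn : dn P q (rt P q y) = lin P q - P.R * (1 - q) * rt P q y := by unfold dn lin; ring
  rw [h2, h3, hdn]
  have := h.R_pos.ne'
  generalize lin P q = A at *
  generalize rt P q y = p at *
  have hAq : P.R * (1 - q) = A - q := by linarith
  field_simp
  obtain rfl : A = q + P.R * (1 - q) := by linarith
  ring

theorem lin_pos (h : Good P) {q : ℝ} (hq0 : 0 ≤ q) (hq1 : q ≤ 1) : 0 < lin P q := by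
  unfold lin
  have := h.R_pos
  rcases hq1.eq_or_lt with rfl | hq1
  · linarith
  · nlinarith [mul_pos this (sub_pos.2 hq1)]

/-- For `q ≤ 1` the second factor in `cc_mul_sl_sub` is positive, so `D` has the sign of `L - y`. -/
theorem dn_pos_of_lt (h : Good P) {q y : ℝ} (hq : 0 < q) (hq1 : q ≤ 1) (hy : 0 < nrt P q y)
    (hl : y < sl P q) : 0 < dn P q (rt P q y) := by
  have hA := h.lin_pos hq.le hq1
  have he := h.cc_mul_sl_sub hy hA.ne'
  have h1 := mul_pos h.cc_pos (sub_pos.2 hl)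
  have h2 : 0 < (1 - q) / P.R + (P.b₂ - 1) / (rt P q y * lin P q) :=
    add_pos_of_nonneg_of_pos (div_nonneg (by linarith) h.R_pos.le)
      (div_pos h.be_pos (mul_pos (h.rt_pos hy) hA))
  by_contra! h3
  nlinarith

/-- To the left of `1` the drift dominates a multiple of `(y - M) / (L - y)`. -/
theorem drift_ge (h : Good P) {q y : ℝ} (hq : 0 < q) (hq1 : q ≤ 1) (hy : 0 < nrt P q y)
    (hm : sm P q ≤ y) (hl : y < sl P q) :
    (y - sm P q) / (lin P q * (sl P q - y)) ≤ (rt P q y - 1) / dn P q (rt P q y) := by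
  have hA := h.lin_pos hq.le hq1
  have hD := h.dn_pos_of_lt hq hq1 hy hl
  have he := h.cc_mul_sl_sub hy hA.ne'
  have he2 := h.rt_eq hy
  have hp := h.rt_pos hy
  have hp1 := (h.one_le_rt_iff hy).2 hm
  have hR := h.R_pos
  have hAR : P.R * (1 - q) ≤ lin P q := by unfold lin; linarith
  have hg := sub_pos.2 hl
  rw [div_le_div_iff₀ (mul_pos hA hg) hD]
  have hc := h.cc_pos
  have h3 : cc P * (y - sm P q) =
      (rt P q y - 1) * ((1 - q) ^ 2 + (P.b₂ - 1) / rt P q y) := by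
    field_simp
    linarith
  refine le_of_mul_le_mul_left ?_ hc
  calc cc P * ((y - sm P q) * dn P q (rt P q y))
      = (rt P q y - 1) * dn P q (rt P q y) * ((1 - q) ^ 2 + (P.b₂ - 1) / rt P q y) := by
        rw [← mul_assoc, h3]; ring
    _ ≤ (rt P q y - 1) * dn P q (rt P q y) *
        (lin P q * ((1 - q) / P.R + (P.b₂ - 1) / (rt P q y * lin P q))) := by
        refine mul_le_mul_of_nonneg_left ?_ (mul_nonneg (by linarith) hD.le)
        have e : lin P q * ((1 - q) / P.R + (P.b₂ - 1) / (rt P q y * lin P q)) =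
          lin P q * ((1 - q) / P.R) + (P.b₂ - 1) / rt P q y := by
          field_simp
        rw [e]
        gcongr
        rw [← mul_div_assoc, le_div_iff₀ hR]
        nlinarith [mul_le_mul_of_nonneg_right hAR (by linarith : 0 ≤ 1 - q)]
    _ = cc P * ((rt P q y - 1) * (lin P q * (sl P q - y))) := by
        linear_combination -(rt P q y - 1) * lin P q * he

/-- At `q = 1` the square root degenerates to `|nphi|`, and `nrt` is positive only where `nphi < 0`.
By this identity that is the condition `y < L(1)`. -/
theorem nphi_one (h : Good P) (y : ℝ) : nphi P 1 y = cc P * (y - sl P 1) := by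
  have := h.b₁_pos.ne'
  have := h.R_pos.ne'
  have := h.ra_pos.ne'
  unfold nphi sl cc lin
  have : (1 - P.R) * 1 + P.R = 1 := by ring
  rw [this]
  field_simp
  ring

theorem nrt_pos_of_lt (h : Good P) {q y : ℝ} (hl : q ≤ 1 → y < sl P q) : 0 < nrt P q y := by
  by_cases hq : q = 1
  · subst hq
    apply h.nrt_pos_of_neg
    rw [h.nphi_one]
    nlinarith [h.cc_pos, hl le_rfl]
  · exact h.nrt_pos_of_ne hq y

theorem sm_lt_sl (h : Good P) {q : ℝ} (hq : 0 < q) (hq1 : q ≤ 1) : sm P q < sl P q := by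
  unfold sl
  have := h.lin_pos hq.le hq1
  have h1 := mul_pos (mul_pos h.be_pos h.R_pos) (div_pos hq this)
  have h2 := mul_nonneg hq.le (sub_nonneg.2 hq1)
  have := mul_pos (div_pos h.ra_pos h.b₁_pos) (add_pos_of_nonneg_of_pos h2 h1)
  linarith

/-- The denominator in the formula for `O` in terms of `p`. -/
theorem den_eq (h : Good P) {q y : ℝ} (hy : 0 < nrt P q y) :
    den P q (sg P * y) = 2 * (1 - P.R) * (1 - q) * dn P q (rt P q y) := by
  have h1 := h.sqrt_eq q y
  unfold den
  rw [h1, h.phi_eq]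
  have hb := h.be_pos
  have hs : (nrt P q y + nphi P q y) ^ 2 =
      nphi P q y ^ 2 + 4 * (P.b₂ - 1) * (1 - q) ^ 2 := by
    unfold nrt
    rw [sub_add_cancel, Real.sq_sqrt]
    have := mul_nonneg hb.le (sq_nonneg (1 - q))
    nlinarith [sq_nonneg (nphi P q y)]
  have hr : √(nphi P q y ^ 2 + 4 * (P.b₂ - 1) * (1 - q) ^ 2) = nrt P q y + nphi P q y := by
    unfold nrt; ring
  rw [hr]
  have hw : rt P q y * nrt P q y = 2 * (P.b₂ - 1) := div_mul_cancel₀ _ hy.ne'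
  change _ - sg P * _ = _
  -- The conjugate `√ + nphi` is the quotient of `4(b₂-1)(1-q)²` by `nrt`, which is `2(1-q)²p`.
  have e : nrt P q y + 2 * nphi P q y = 2 * (1 - q) ^ 2 * rt P q y := by
    have : nrt P q y * (nrt P q y + 2 * nphi P q y) =
        nrt P q y * (2 * (1 - q) ^ 2 * rt P q y) := by
      linear_combination hs - 2 * (1 - q) ^ 2 * hw
    exact mul_left_cancel₀ hy.ne' this
  unfold dn
  linear_combination (-P.R) * e * (1 - P.R) - P.R * (nrt P q y + 2 * nphi P q y) * h.sg_mul_ra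

/-- Over a common denominator the numerator contains `D - q = -R(1-q)(p-1)`. Its factor `1-q`
cancels the pole at `q = 1`. -/
theorem Oraw_eq (h : Good P) {q y : ℝ} (hq : q ≠ 1) (hD : dn P q (rt P q y) ≠ 0) :
    Oraw P q (sg P * y) =
      sg P * y * (-(1 - P.R) * ((rt P q y - 1) / dn P q (rt P q y))) := by
  have hy := h.nrt_pos_of_ne hq y
  unfold Oraw
  rw [h.den_eq hy]
  have := h.R_pos.ne'
  have h1 : 1 - P.R ≠ 0 := sub_ne_zero.2 h.R_ne.symm
  have h2 : 1 - q ≠ 0 := sub_ne_zero.2 hq.symm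
  have e : dn P q (rt P q y) - q = -(P.R * (1 - q) * (rt P q y - 1)) := by unfold dn; ring
  generalize dn P q (rt P q y) = D at *
  field_simp
  linear_combination sg P * y * e

end Good

variable (P)

/-- The formula for `F` in terms of `p`. -/
def slope (q y : ℝ) : ℝ := -(1 - P.R) * ((rt P q y - 1) / dn P q (rt P q y))

variable {P}

/-! ### Smoothness across `q = 1` and `n = 0`, and the resulting formulas for `O` and `F`. -/

namespace Good

theorem contDiff_nphi : ContDiff ℝ 1 (fun z : ℝ × ℝ => nphi P z.1 z.2) := by
  unfold nphi sm
  fun_prop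

theorem contDiffAt_nrt {z : ℝ × ℝ} (hz : 0 < nrt P z.1 z.2) (h : Good P) :
    ContDiffAt ℝ 1 (fun z : ℝ × ℝ => nrt P z.1 z.2) z := by
  have h1 : ContDiff ℝ 1 (fun z : ℝ × ℝ => nphi P z.1 z.2) := contDiff_nphi
  have h2 : nphi P z.1 z.2 ^ 2 + 4 * (P.b₂ - 1) * (1 - z.1) ^ 2 ≠ 0 := by
    intro h0
    unfold nrt at hz
    rw [h0, Real.sqrt_zero] at hz
    have := h.be_pos
    have : 0 < nphi P z.1 z.2 ^ 2 := by nlinarith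
    nlinarith [mul_nonneg h.be_pos.le (sq_nonneg (1 - z.1))]
  unfold nrt
  refine ContDiffAt.sub (ContDiffAt.sqrt ?_ h2) h1.contDiffAt
  exact ((h1.pow 2).add (by fun_prop)).contDiffAt

theorem contDiffAt_rt {z : ℝ × ℝ} (hz : 0 < nrt P z.1 z.2) (h : Good P) :
    ContDiffAt ℝ 1 (fun z : ℝ × ℝ => rt P z.1 z.2) z := by
  unfold rt
  exact contDiffAt_const.div (h.contDiffAt_nrt hz) hz.ne'

theorem contDiffAt_dn {z : ℝ × ℝ} (hz : 0 < nrt P z.1 z.2) (h : Good P) :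
    ContDiffAt ℝ 1 (fun z : ℝ × ℝ => dn P z.1 (rt P z.1 z.2)) z := by
  have := h.contDiffAt_rt hz
  unfold dn
  fun_prop

theorem contDiffAt_slope {z : ℝ × ℝ} (hz : 0 < nrt P z.1 z.2)
    (hD : dn P z.1 (rt P z.1 z.2) ≠ 0) (h : Good P) :
    ContDiffAt ℝ 1 (fun z : ℝ × ℝ => slope P z.1 z.2) z := by
  unfold slope
  exact contDiffAt_const.mul
    (((h.contDiffAt_rt hz).sub contDiffAt_const).div (h.contDiffAt_dn hz) hD)

/-- The points near which the formula for `O` is smooth form an open set. -/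
theorem eventually_smooth {z : ℝ × ℝ} (hz : 0 < nrt P z.1 z.2)
    (hD : dn P z.1 (rt P z.1 z.2) ≠ 0) (h : Good P) :
    ∀ᶠ w in 𝓝 z, 0 < nrt P w.1 w.2 ∧ dn P w.1 (rt P w.1 w.2) ≠ 0 :=
  ((h.contDiffAt_nrt hz).continuousAt.eventually_const_lt hz).and
    ((h.contDiffAt_dn hz).continuousAt.eventually_ne hD)

theorem O_eq (h : Good P) {q y : ℝ} (hz : 0 < nrt P q y) (hD : dn P q (rt P q y) ≠ 0) :
    O P q (sg P * y) = sg P * y * slope P q y := by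
  by_cases hq : q = 1
  · subst hq
    rw [O, if_pos rfl]
    apply Tendsto.limUnder_eq
    have hc : Tendsto (fun x : ℝ => ((x, y) : ℝ × ℝ)) (𝓝[≠] 1) (𝓝 (1, y)) :=
      ((Continuous.prodMk_left y).tendsto 1).mono_left nhdsWithin_le_nhds
    have h1 : Tendsto (fun x => sg P * y * slope P x y) (𝓝[≠] 1) (𝓝 (sg P * y * slope P 1 y)) :=
      (((h.contDiffAt_slope (z := (1, y)) hz hD).continuousAt.tendsto.comp hc).const_mul _)
    refine h1.congr' ?_
    filter_upwards [hc.eventually (h.eventually_smooth (z := (1, y)) hz hD),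
      self_mem_nhdsWithin] with x hx hx1
    rw [h.Oraw_eq hx1 hx.2]; rfl
  · rw [O, if_neg hq, h.Oraw_eq hq hD]; rfl

theorem F_eq (h : Good P) {q y : ℝ} (hz : 0 < nrt P q y) (hD : dn P q (rt P q y) ≠ 0) :
    F P q (sg P * y) = slope P q y := by
  have hs : sg P ≠ 0 := by intro h0; have := h.sg_sq; rw [h0] at this; norm_num at this
  by_cases hy : y = 0
  · subst hy
    rw [mul_zero, F, if_pos rfl]
    apply Tendsto.limUnder_eq
    have hc : Tendsto (fun k : ℝ => ((q, sg P * k) : ℝ × ℝ)) (𝓝[>] 0) (𝓝 (q, 0)) := by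
      have : Continuous (fun k : ℝ => ((q, sg P * k) : ℝ × ℝ)) := by fun_prop
      have := (this.tendsto 0).mono_left (nhdsWithin_le_nhds (s := Ioi 0))
      simpa using this
    refine ((h.contDiffAt_slope (z := (q, 0)) hz hD).continuousAt.tendsto.comp hc).congr' ?_
    filter_upwards [hc.eventually (h.eventually_smooth (z := (q, 0)) hz hD),
      self_mem_nhdsWithin] with k hk hk0
    have e := h.O_eq hk.1 hk.2
    simp only [h.sg_sg] at e
    rw [e, mul_div_cancel_left₀ _ (ne_of_gt hk0)]
    rfl
  · rw [F, if_neg (mul_ne_zero hs hy), h.O_eq hz hD, mul_div_cancel_left₀ _ (mul_ne_zero hs hy)]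

/-- For `q ≤ 1` the condition `D ≠ 0` is automatic from `y < L`. For `q > 1` the denominator and `D`
differ by the nonzero factor `2(1-R)(1-q)`. -/
theorem regular_iff (h : Good P) {q y : ℝ} : Regular P q (sg P * y) ↔
    0 < q ∧ 0 ≤ sg P * y ∧ (q ≤ 1 → y < sl P q) ∧ dn P q (rt P q y) ≠ 0 := by
  have h0 : 1 - P.R ≠ 0 := sub_ne_zero.2 h.R_ne.symm
  unfold Regular
  rw [h.mul_lt_mul_iff_sg, h.sg_sg, ← h.sl_eq]
  refine and_congr_right fun hq => and_congr_right fun _ => and_congr_right fun hl => ?_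
  constructor
  · intro hd
    rcases le_or_gt q 1 with h1 | h1
    · exact (h.dn_pos_of_lt hq h1 (h.nrt_pos_of_lt hl) (hl h1)).ne'
    · have := hd h1.ne'
      rw [h.den_eq (h.nrt_pos_of_lt hl)] at this
      exact right_ne_zero_of_mul this
  · intro hd hq1
    rw [h.den_eq (h.nrt_pos_of_lt hl)]
    have : 1 - q ≠ 0 := sub_ne_zero.2 hq1.symm
    positivity

/-- The integrand of the round-trip cost in terms of `p`. -/
theorem integrand_eq (h : Good P) {f : ℝ → ℝ} {q y : ℝ} (hf : f q = sg P * y)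
    (hz : 0 < nrt P q y) (hD : dn P q (rt P q y) ≠ 0) :
    integrand P f q = P.R / q * ((rt P q y - 1) / dn P q (rt P q y)) := by
  have h0 : 1 - P.R ≠ 0 := sub_ne_zero.2 h.R_ne.symm
  unfold integrand
  rw [hf, h.F_eq hz hD, slope]
  field_simp

/-! ### Uniqueness of solutions. -/

/-- Two solutions of a locally smooth scalar equation with the same initial value agree. -/
theorem _root_.eqOn_of_contDiffAt_field {v : ℝ × ℝ → ℝ} {f g : ℝ → ℝ} {a b : ℝ}
    (hf : ∀ t ∈ Icc a b, HasDerivWithinAt f (v (t, f t)) (Icc a b) t)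
    (hg : ∀ t ∈ Icc a b, HasDerivWithinAt g (v (t, g t)) (Icc a b) t)
    (hv : ∀ t ∈ Icc a b, ContDiffAt ℝ 1 v (t, f t)) (hab : f a = g a) :
    EqOn f g (Icc a b) := by
  have hfc : ContinuousOn f (Icc a b) := fun t ht => (hf t ht).continuousWithinAt
  have hgc : ContinuousOn g (Icc a b) := fun t ht => (hg t ht).continuousWithinAt
  -- Continuous induction: the set of agreement is closed, and a local Lipschitz constant at each
  -- point of agreement extends it to the right.
  refine IsClosed.Icc_subset_of_forall_exists_gt (s := {t | f t = g t}) ?_ hab ?_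
  · have : {t | f t = g t} ∩ Icc a b = Icc a b ∩ (fun t => f t - g t) ⁻¹' {0} := by
      ext t; simp [sub_eq_zero, and_comm]
    rw [this]
    exact (hfc.sub hgc).preimage_isClosed_of_isClosed isClosed_Icc isClosed_singleton
  · rintro x ⟨hx, hxI⟩ y hy
    have hxm : x ∈ Icc a b := Ico_subset_Icc_self hxI
    obtain ⟨K, s, hs, hL⟩ := (hv x hxm).exists_lipschitzOnWith
    have hsub : Ici x ⊆ Ici a := Ici_subset_Ici.2 hxI.1
    have tend : ∀ k : ℝ → ℝ, ContinuousOn k (Icc a b) → k x = f x →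
        ∀ᶠ t in 𝓝[≥] x, (t, k t) ∈ s := by
      intro k hk hkx
      have h1 : ContinuousWithinAt k (Icc a b) x := hk x hxm
      have h2 : ContinuousWithinAt k (Ici x) x := by
        refine h1.mono_of_mem_nhdsWithin ?_
        exact mem_of_superset (Icc_mem_nhdsGE hxI.2) (Icc_subset_Icc_left hxI.1)
      have h3 : Tendsto (fun t => (t, k t)) (𝓝[≥] x) (𝓝 (x, f x)) := by
        rw [← hkx]
        exact (continuousWithinAt_id.prodMk h2)
      exact h3 hs
    have e := (tend f hfc rfl).and (tend g hgc hx.symm)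
    obtain ⟨c, hc, hcs⟩ := (mem_nhdsGE_iff_exists_Icc_subset).1 e
    set d := min c (min b y) with hd
    have hxd : x < d := lt_min hc (lt_min hxI.2 hy)
    have hdb : d ≤ b := (min_le_right _ _).trans (min_le_left _ _)
    have key : EqOn f g (Icc x d) := by
      have hmem : ∀ t ∈ Ico x d, t ∈ Ico a b := fun t ht =>
        ⟨hxI.1.trans ht.1, ht.2.trans_le hdb⟩
      refine ODE_solution_unique_of_mem_Icc_right (v := fun t z => v (t, z))
        (s := fun t => {z | (t, z) ∈ s}) (K := K) ?_ (hfc.mono ?_) ?_ ?_ (hgc.mono ?_) ?_ ?_ hx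
      · intro t _ z hz w hw
        have := hL hz hw
        simpa [Prod.edist_eq] using this
      · exact Icc_subset_Icc hxI.1 hdb
      · intro t ht
        exact (hf t (Ico_subset_Icc_self (hmem t ht))).mono_of_mem_nhdsWithin
          (mem_of_superset (Icc_mem_nhdsGE (hmem t ht).2) (Icc_subset_Icc_left (hmem t ht).1))
      · intro t ht
        exact (hcs ⟨ht.1, ht.2.le.trans (min_le_left _ _)⟩).1
      · exact Icc_subset_Icc hxI.1 hdb
      · intro t ht
        exact (hg t (Ico_subset_Icc_self (hmem t ht))).mono_of_mem_nhdsWithin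
          (mem_of_superset (Icc_mem_nhdsGE (hmem t ht).2) (Icc_subset_Icc_left (hmem t ht).1))
      · intro t ht
        exact (hcs ⟨ht.1, ht.2.le.trans (min_le_left _ _)⟩).2
    exact ⟨d, key ⟨hxd.le, le_rfl⟩, hxd, (min_le_right _ _).trans (min_le_right _ _)⟩

/-- Uniqueness for the initial value problem. -/
theorem solution_unique (h : Good P) {u z : ℝ} {f g : ℝ → ℝ} (hf : IsSolution P u z f)
    (hg : IsSolution P u z g) : EqOn f g (Icc u z) := by
  have hsmooth : ∀ q n, Regular P q n → 0 < nrt P q (sg P * n) ∧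
      dn P q (rt P q (sg P * n)) ≠ 0 := by
    intro q n hr
    rw [← h.sg_sg n, h.regular_iff] at hr
    exact ⟨h.nrt_pos_of_lt hr.2.2.1, hr.2.2.2⟩
  have hO : ∀ q n, Regular P q n → O P q n = n * slope P q (sg P * n) := by
    intro q n hr
    have := hsmooth q n hr
    have e := h.O_eq this.1 this.2
    rwa [h.sg_sg] at e
  refine eqOn_of_contDiffAt_field (v := fun z : ℝ × ℝ => z.2 * slope P z.1 (sg P * z.2))
    ?_ ?_ ?_ (hf.1.trans hg.1.symm)
  · intro t ht
    have := (hf.2 t ht).2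
    rwa [hO t _ (hf.2 t ht).1] at this
  · intro t ht
    have := (hg.2 t ht).2
    rwa [hO t _ (hg.2 t ht).1] at this
  · intro t ht
    have := hsmooth t _ (hf.2 t ht).1
    have h1 := h.contDiffAt_slope (z := (t, sg P * f t)) this.1 this.2
    have h2 : ContDiffAt ℝ 1 (fun z : ℝ × ℝ => (z.1, sg P * z.2)) (t, f t) := by fun_prop
    have h3 : ContDiffAt ℝ 1 (fun z : ℝ × ℝ => slope P z.1 (sg P * z.2)) (t, f t) :=
      ContDiffAt.comp (f := fun z : ℝ × ℝ => (z.1, sg P * z.2))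
        (g := fun z : ℝ × ℝ => slope P z.1 z.2) (t, f t) h1 h2
    exact contDiffAt_snd.mul h3

/-- `nSol` chooses a separate solution for every endpoint `q`; uniqueness makes these choices fit
together. -/
theorem nSol_eq (h : Good P) {u z : ℝ} {f : ℝ → ℝ} (hf : IsSolution P u z f) :
    EqOn f (nSol P u) (Icc u z) := by
  intro q hq
  have hfq : IsSolution P u q f := ⟨hf.1, fun t ht =>
    have ht' : t ∈ Icc u z := ⟨ht.1, ht.2.trans hq.2⟩
    ⟨(hf.2 t ht').1, (hf.2 t ht').2.mono (Icc_subset_Icc_right hq.2)⟩⟩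
  have hex : ∃ f, IsSolution P u q f := ⟨f, hfq⟩
  rw [nSol, dif_pos hex]
  exact h.solution_unique hfq hex.choose_spec ⟨hq.1, le_rfl⟩

end Good

theorem div_mul_le_div_mul {c w a b x y : ℝ} (hc : 0 ≤ c) (hw : 0 < w) (ha : w ≤ a) (hb : w ≤ b)
    (hx : 0 ≤ x) (hxy : x ≤ y) : c / (a * b) * x ≤ c / (w * w) * y := by
  have := hw.le.trans ha
  gcongr

/-! ### The cut-off field and its parameters. -/

variable (P)

/-- The quotient `(p - 1) / D` with `p` cut off from below at `θ`. -/
def kern (θ q y : ℝ) : ℝ := (max (rt P q y) θ - 1) / dn P q (max (rt P q y) θ)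

/-- The upper bound at which the field is cut off. -/
def hi (δ q : ℝ) : ℝ := max (sl P (min q 1) - δ) (sm P q)

/-- The projection of `y` to the interval `[-Λ, hi(q)]`. -/
def cl (δ Λ q y : ℝ) : ℝ := max (-Λ) (min y (hi P δ q))

/-- The level at which `p` is cut off in the field. -/
def lowRt : ℝ := 1 - 1 / P.R

/-- The cut-off field. -/
def fld (δ Λ q y : ℝ) : ℝ :=
  -(ra P * max 0 (sg P * cl P δ Λ q y) * kern P (lowRt P) q (cl P δ Λ q y))

/-- The derivative of `sgn(1-R) m`. -/
def smDeriv (q : ℝ) : ℝ := ra P / P.b₁ * (2 * P.R * q - P.b₃)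

/-- The derivative of `sgn(1-R) ℓ`. -/
def slDeriv (q : ℝ) : ℝ :=
  smDeriv P q + ra P / P.b₁ * (1 - 2 * q + (P.b₂ - 1) * P.R * (P.R / lin P q ^ 2))

/-- Constants for which the cut-off field on `[u₁, T]` is not affected by the cut-off
along the solutions of interest. -/
structure Box (u₁ T δ Λ : ℝ) : Prop where
  pos : 0 < u₁
  lt_one : u₁ < 1
  le_T : 2 * qM P + 1 ≤ T
  δ_pos : 0 < δ
  Λ_pos : 0 < Λ
  gap : ∀ q ∈ Icc u₁ 1, 4 * δ ≤ sl P q - sm P q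
  lower : ∀ q ∈ Icc u₁ T, -Λ < sm P q
  top : P.R < 1 → ∀ q ∈ Icc u₁ 1, 2 * δ < sl P q
  barrier : ∀ q ∈ Icc u₁ 1, ∀ y ∈ Icc (sl P q - 2 * δ) (sl P q - δ), (1 < P.R → y ≤ -1) →
    0 < slDeriv P q + ra P * (sg P * y) * ((y - sm P q) / (lin P q * (sl P q - y)))

variable {P}

theorem hasDerivAt_sm (q : ℝ) : HasDerivAt (sm P) (smDeriv P q) q := by
  unfold sm smDeriv
  have h1 := (((hasDerivAt_pow 2 q).const_mul P.R).sub
    ((hasDerivAt_id q).const_mul P.b₃)).const_mul (ra P / P.b₁) |>.add_const (sg P)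
  refine h1.congr_deriv ?_
  push_cast
  ring

theorem continuous_sm : Continuous (sm P) := by unfold sm; fun_prop

theorem hasDerivAt_sl {q : ℝ} (hq : lin P q ≠ 0) : HasDerivAt (sl P) (slDeriv P q) q := by
  have hl : HasDerivAt (lin P) (1 - P.R) q := by
    unfold lin
    have := ((hasDerivAt_id q).const_mul (1 - P.R)).add_const P.R
    simpa using this
  have h1 := (((hasDerivAt_id q).mul ((hasDerivAt_id q).const_sub 1)).add
    (((hasDerivAt_id q).div hl hq).const_mul ((P.b₂ - 1) * P.R))).const_mul (ra P / P.b₁)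
  have h2 := (hasDerivAt_sm (P := P) q).add h1
  refine h2.congr_deriv ?_
  have : lin P q - q * (1 - P.R) = P.R := by unfold lin; ring
  simp only [id, slDeriv]
  simp only [one_mul, this]
  ring

namespace Good

theorem qM_pos (h : Good P) : 0 < qM P := div_pos h.b₃_pos (mul_pos two_pos h.R_pos)

theorem smDeriv_eq (h : Good P) (q : ℝ) : smDeriv P q = 2 * P.R * (ra P / P.b₁) * (q - qM P) := by
  have := h.R_pos.ne'
  unfold smDeriv qM
  field_simp

/-- After normalisation the leading coefficient is positive for either sign of `1-R`. The
monotonicity and the mirror symmetry about `q_M` follow from this form. -/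
theorem sm_eq_sq (h : Good P) (q : ℝ) :
    sm P q = P.R * (ra P / P.b₁) * (q - qM P) ^ 2 + sm P (qM P) := by
  have := h.R_pos.ne'
  unfold sm qM
  field_simp
  ring

theorem sm_anti (h : Good P) {x y : ℝ} (hxy : x ≤ y) (hy : y ≤ qM P) : sm P y ≤ sm P x := by
  rw [h.sm_eq_sq x, h.sm_eq_sq y]
  have := mul_pos h.R_pos (div_pos h.ra_pos h.b₁_pos)
  have : (y - qM P) ^ 2 ≤ (x - qM P) ^ 2 := by nlinarith
  gcongr

theorem sm_symm (h : Good P) (q : ℝ) : sm P (2 * qM P - q) = sm P q := by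
  rw [h.sm_eq_sq, h.sm_eq_sq q]; ring

/-- The cut-off denominator is positive. -/
theorem dn_max_pos (h : Good P) {q y θ : ℝ} (hq : 0 < q) (hl : q ≤ 1 → y < sl P q)
    (hθ : lowRt P ≤ θ) (hθ1 : θ ≤ 1) : 0 < dn P q (max (rt P q y) θ) := by
  have hR := h.R_pos
  have hz := h.nrt_pos_of_lt hl
  rcases le_or_gt 1 (rt P q y) with hp | hp
  · rw [max_eq_left (hθ1.trans hp)]
    rcases le_or_gt q 1 with hq1 | hq1
    · exact h.dn_pos_of_lt hq hq1 hz (hl hq1)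
    · unfold dn
      nlinarith [mul_nonneg (mul_nonneg hR.le (sub_nonneg.2 hq1.le)) (sub_nonneg.2 hp)]
  · have hp1 : max (rt P q y) θ ≤ 1 := max_le hp.le hθ1
    have hp2 : lowRt P ≤ max (rt P q y) θ := hθ.trans (le_max_right _ _)
    generalize max (rt P q y) θ = p at *
    unfold dn
    rcases le_or_gt q 1 with hq1 | hq1
    · nlinarith [mul_nonneg (mul_nonneg hR.le (sub_nonneg.2 hq1)) (sub_nonneg.2 hp1)]
    -- The level `1 - 1/R` is chosen for this bound: for `q > 1` it yields `D ≥ q - (q-1) = 1`.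
    · have : P.R * (1 - p) ≤ 1 := by
        have : 1 - p ≤ 1 / P.R := by unfold lowRt at hp2; linarith
        calc P.R * (1 - p) ≤ P.R * (1 / P.R) := by gcongr
          _ = 1 := by field_simp
      nlinarith [mul_le_mul_of_nonneg_right this (sub_nonneg.2 hq1.le)]

theorem lowRt_lt (h : Good P) : lowRt P < 1 := by
  have := one_div_pos.2 h.R_pos
  unfold lowRt; linarith

/-- The map `t ↦ √(t² + e) - t` is nonincreasing and 2-Lipschitz for `e ≥ 0`, and `nphi` is affine
in `y` with slope `c`. -/
theorem nrt_anti (h : Good P) (q : ℝ) {y y' : ℝ} (hy : y ≤ y') :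
    nrt P q y' ≤ nrt P q y ∧ nrt P q y - nrt P q y' ≤ 2 * cc P * (y' - y) := by
  have ht : nphi P q y' - nphi P q y = cc P * (y' - y) := by unfold nphi; ring
  have hd : 0 ≤ cc P * (y' - y) := mul_nonneg h.cc_pos.le (by linarith)
  unfold nrt
  set e := 4 * (P.b₂ - 1) * (1 - q) ^ 2 with he
  have he0 : 0 ≤ e := by have := h.be_pos; positivity
  have key : ∀ a b : ℝ, √(a ^ 2 + e) ≤ √(b ^ 2 + e) + |a - b| := by
    intro a b
    rw [Real.sqrt_le_iff]
    refine ⟨by positivity, ?_⟩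
    have h1 := Real.sq_sqrt (by positivity : 0 ≤ b ^ 2 + e)
    have h2 : |b| ≤ √(b ^ 2 + e) := Real.abs_le_sqrt (by linarith)
    have h3 : b * (a - b) ≤ √(b ^ 2 + e) * |a - b| := by
      calc b * (a - b) ≤ |b * (a - b)| := le_abs_self _
        _ = |b| * |a - b| := abs_mul _ _
        _ ≤ _ := by gcongr
    nlinarith [sq_abs (a - b)]
  have k1 := key (nphi P q y') (nphi P q y)
  have k2 := key (nphi P q y) (nphi P q y')
  rw [abs_sub_comm, ht, abs_of_nonneg hd] at k2
  rw [ht, abs_of_nonneg hd] at k1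
  constructor <;> linarith

theorem rt_mono (h : Good P) {q y y' : ℝ} (hy : y ≤ y') (hz : 0 < nrt P q y') :
    rt P q y ≤ rt P q y' := by
  unfold rt
  have := (h.nrt_anti q hy).1
  have := h.be_pos
  gcongr

/-- In the difference of the quotients `(p-1)/D` the terms with `R(1-q)` cancel, leaving only `q`
times the difference of the roots. So the quotient increases with `p`, which gives both monotonicity
and the Lipschitz bound. -/
theorem kern_sub (_h : Good P) {q y y' θ : ℝ} (hD : 0 < dn P q (max (rt P q y) θ))
    (hD' : 0 < dn P q (max (rt P q y') θ)) :
    kern P θ q y - kern P θ q y' = q * (max (rt P q y) θ - max (rt P q y') θ) /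
      (dn P q (max (rt P q y) θ) * dn P q (max (rt P q y') θ)) := by
  unfold kern
  rw [div_sub_div _ _ hD.ne' hD'.ne']
  congr 1
  unfold dn; ring

theorem kern_mono (h : Good P) {q y y' θ : ℝ} (hq : 0 < q) (hl : q ≤ 1 → y' < sl P q)
    (hθ : lowRt P ≤ θ) (hθ1 : θ ≤ 1) (hy : y ≤ y') : kern P θ q y ≤ kern P θ q y' := by
  have hD' := h.dn_max_pos hq hl hθ hθ1
  have hD := h.dn_max_pos (y := y) hq (fun hq1 => hy.trans_lt (hl hq1)) hθ hθ1
  rw [← sub_nonneg, h.kern_sub hD' hD]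
  have := sub_nonneg.2 (max_le_max_right θ (h.rt_mono hy (h.nrt_pos_of_lt hl)))
  positivity

end Good

/-- The region to which the field is cut off. -/
def strip (P : Params) (u₁ T δ Λ : ℝ) : Set (ℝ × ℝ) :=
  {z | z.1 ∈ Icc u₁ T ∧ z.2 ∈ Icc (-Λ) (hi P δ z.1)}

/-! ### Compactness and Lipschitz bounds on the strip. -/

namespace Box

variable {u₁ T δ Λ : ℝ}

theorem le_hi (_B : Box P u₁ T δ Λ) (q : ℝ) : sm P q ≤ hi P δ q := le_max_right _ _

theorem hi_eq (B : Box P u₁ T δ Λ) {q : ℝ} (hq : q ∈ Icc u₁ 1) : hi P δ q = sl P q - δ := by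
  unfold hi
  rw [min_eq_left hq.2, max_eq_left]
  linarith [B.gap q hq, B.δ_pos]

theorem cl_mem (B : Box P u₁ T δ Λ) {q : ℝ} (hq : q ∈ Icc u₁ T) (y : ℝ) :
    (q, cl P δ Λ q y) ∈ strip P u₁ T δ Λ :=
  ⟨hq, le_max_left _ _, max_le ((B.lower q hq).le.trans (B.le_hi q)) (min_le_right _ _)⟩

theorem cl_eq (_B : Box P u₁ T δ Λ) {q y : ℝ} (h1 : -Λ ≤ y) (h2 : y ≤ hi P δ q) :
    cl P δ Λ q y = y := by
  unfold cl; rw [min_eq_left h2, max_eq_right h1]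

theorem lt_sl (B : Box P u₁ T δ Λ) {z : ℝ × ℝ} (hz : z ∈ strip P u₁ T δ Λ) (h1 : z.1 ≤ 1) :
    z.2 < sl P z.1 := by
  have := hz.2.2
  rw [B.hi_eq ⟨hz.1.1, h1⟩] at this
  linarith [B.δ_pos]

theorem fst_pos (B : Box P u₁ T δ Λ) {z : ℝ × ℝ} (hz : z ∈ strip P u₁ T δ Λ) : 0 < z.1 :=
  B.pos.trans_le hz.1.1

theorem one_le_T (B : Box P u₁ T δ Λ) (h : Good P) : 1 < T := by
  linarith [B.le_T, h.qM_pos]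

theorem continuousOn_hi (B : Box P u₁ T δ Λ) (h : Good P) : ContinuousOn (hi P δ) (Icc u₁ T) := by
  unfold hi
  refine ContinuousOn.sup (ContinuousOn.sub ?_ continuousOn_const) continuous_sm.continuousOn
  have h1 : ContinuousOn (sl P) (Icc u₁ 1) := fun q hq =>
    (hasDerivAt_sl (h.lin_pos (B.pos.le.trans hq.1) hq.2).ne').continuousAt.continuousWithinAt
  exact h1.comp (by fun_prop) fun q hq => ⟨le_min hq.1 B.lt_one.le, min_le_right _ _⟩

theorem isCompact_strip (B : Box P u₁ T δ Λ) (h : Good P) : IsCompact (strip P u₁ T δ Λ) := by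
  obtain ⟨C, hC⟩ := isCompact_Icc.bddAbove_image (B.continuousOn_hi h)
  refine (isCompact_Icc (a := u₁) (b := T)).prod (isCompact_Icc (a := -Λ) (b := C))
    |>.of_isClosed_subset ?_ ?_
  · have h1 : IsClosed (Icc u₁ T ×ˢ (univ : Set ℝ)) := isClosed_Icc.prod isClosed_univ
    have h2 : ContinuousOn (fun z : ℝ × ℝ => z.2 - hi P δ z.1) (Icc u₁ T ×ˢ univ) :=
      continuousOn_snd.sub ((B.continuousOn_hi h).comp continuousOn_fst fun z hz => hz.1)
    have h3 := h2.preimage_isClosed_of_isClosed h1 (isClosed_Iic (a := 0))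
    have h4 : IsClosed {z : ℝ × ℝ | -Λ ≤ z.2} := isClosed_le continuous_const continuous_snd
    convert h3.inter h4 using 1
    ext z
    simp only [strip, mem_ofPred_eq, mem_inter_iff, mem_prod, mem_univ, and_true, mem_preimage,
      mem_Iic, sub_nonpos, mem_Icc]
    tauto
  · rintro z ⟨h1, h2⟩
    exact ⟨h1, h2.1, h2.2.trans (hC ⟨z.1, h1, rfl⟩)⟩

theorem nonempty_strip (B : Box P u₁ T δ Λ) (h : Good P) : (strip P u₁ T δ Λ).Nonempty :=
  ⟨_, B.cl_mem ⟨le_rfl, (B.lt_one.trans (B.one_le_T h)).le⟩ 0⟩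

theorem nrt_pos (B : Box P u₁ T δ Λ) (h : Good P) {z : ℝ × ℝ} (hz : z ∈ strip P u₁ T δ Λ) :
    0 < nrt P z.1 z.2 := h.nrt_pos_of_lt (B.lt_sl hz)

theorem dn_pos (B : Box P u₁ T δ Λ) (h : Good P) {θ : ℝ} (hθ : lowRt P ≤ θ) (hθ1 : θ ≤ 1)
    {z : ℝ × ℝ} (hz : z ∈ strip P u₁ T δ Λ) : 0 < dn P z.1 (max (rt P z.1 z.2) θ) :=
  h.dn_max_pos (B.fst_pos hz) (B.lt_sl hz) hθ hθ1

theorem continuousOn_max_rt (B : Box P u₁ T δ Λ) (h : Good P) (θ : ℝ) :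
    ContinuousOn (fun z : ℝ × ℝ => max (rt P z.1 z.2) θ) (strip P u₁ T δ Λ) :=
  ContinuousOn.sup (fun _ hz =>
    (h.contDiffAt_rt (B.nrt_pos h hz)).continuousAt.continuousWithinAt) continuousOn_const

theorem continuousOn_dn (B : Box P u₁ T δ Λ) (h : Good P) (θ : ℝ) :
    ContinuousOn (fun z : ℝ × ℝ => dn P z.1 (max (rt P z.1 z.2) θ)) (strip P u₁ T δ Λ) := by
  have := B.continuousOn_max_rt h θ
  unfold dn
  fun_prop

theorem continuousOn_kern (B : Box P u₁ T δ Λ) (h : Good P) {θ : ℝ} (hθ : lowRt P ≤ θ)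
    (hθ1 : θ ≤ 1) : ContinuousOn (fun z : ℝ × ℝ => kern P θ z.1 z.2) (strip P u₁ T δ Λ) :=
  ((B.continuousOn_max_rt h θ).sub continuousOn_const).div (B.continuousOn_dn h θ)
    fun _ hz => (B.dn_pos h hθ hθ1 hz).ne'

theorem exists_kern_bound (B : Box P u₁ T δ Λ) (h : Good P) {θ : ℝ} (hθ : lowRt P ≤ θ)
    (hθ1 : θ ≤ 1) : ∃ C, 0 ≤ C ∧ ∀ z ∈ strip P u₁ T δ Λ, |kern P θ z.1 z.2| ≤ C := by
  obtain ⟨C, hC⟩ := (B.isCompact_strip h).exists_bound_of_continuousOn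
    (B.continuousOn_kern h hθ hθ1)
  exact ⟨max C 0, le_max_right _ _, fun _ hz => (hC _ hz).trans (le_max_left _ _)⟩

theorem exists_le_nrt (B : Box P u₁ T δ Λ) (h : Good P) :
    ∃ w, 0 < w ∧ ∀ z ∈ strip P u₁ T δ Λ, w ≤ nrt P z.1 z.2 := by
  obtain ⟨z₀, hz₀, hw⟩ := (B.isCompact_strip h).exists_isMinOn (B.nonempty_strip h)
    (f := fun z => nrt P z.1 z.2) fun z hz =>
      (h.contDiffAt_nrt (B.nrt_pos h hz)).continuousAt.continuousWithinAt
  exact ⟨_, B.nrt_pos h hz₀, fun z hz => isMinOn_iff.1 hw z hz⟩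

theorem exists_le_dn (B : Box P u₁ T δ Λ) (h : Good P) {θ : ℝ} (hθ : lowRt P ≤ θ)
    (hθ1 : θ ≤ 1) :
    ∃ d, 0 < d ∧ ∀ z ∈ strip P u₁ T δ Λ, d ≤ dn P z.1 (max (rt P z.1 z.2) θ) := by
  obtain ⟨z₁, hz₁, hd⟩ := (B.isCompact_strip h).exists_isMinOn (B.nonempty_strip h)
    (B.continuousOn_dn h θ)
  exact ⟨_, B.dn_pos h hθ hθ1 hz₁, fun z hz => isMinOn_iff.1 hd z hz⟩

theorem _root_.RoundTrip.Good.rt_sub_le (h : Good P) {q y y' w : ℝ} (hle : y ≤ y') (hw : 0 < w)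
    (hwy : w ≤ nrt P q y) (hwy' : w ≤ nrt P q y') :
    rt P q y' - rt P q y ≤ 2 * (P.b₂ - 1) / (w * w) * (2 * cc P * (y' - y)) := by
  have hb := h.be_pos
  have hW := hw.trans_le hwy
  have hW' := hw.trans_le hwy'
  have e : rt P q y' - rt P q y =
      2 * (P.b₂ - 1) / (nrt P q y' * nrt P q y) * (nrt P q y - nrt P q y') := by
    unfold rt; field_simp
  have hn := h.nrt_anti q hle
  rw [e]
  exact div_mul_le_div_mul (by positivity) hw hwy' hwy (sub_nonneg.2 hn.1) hn.2

theorem _root_.max_sub_max_le_sub {a b θ : ℝ} (hab : a ≤ b) : max b θ - max a θ ≤ b - a := by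
  rcases le_total θ a with hh | hh
  · rw [max_eq_left hh, max_eq_left (hh.trans hab)]
  · rw [max_eq_right hh]
    have := max_le (by linarith : b ≤ θ + (b - a)) (by linarith : θ ≤ θ + (b - a))
    linarith

theorem _root_.RoundTrip.Good.kern_sub_le (h : Good P) {q y y' w d θ S : ℝ} (hq : 0 < q)
    (hqS : q ≤ S) (hle : y ≤ y') (hw : 0 < w) (hwy : w ≤ nrt P q y) (hwy' : w ≤ nrt P q y')
    (hd : 0 < d) (hdy : d ≤ dn P q (max (rt P q y) θ)) (hdy' : d ≤ dn P q (max (rt P q y') θ)) :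
    |kern P θ q y' - kern P θ q y| ≤
      S / (d * d) * (2 * (P.b₂ - 1) / (w * w) * (2 * cc P)) * (y' - y) := by
  have hD := hd.trans_le hdy
  have hD' := hd.trans_le hdy'
  have e1 := h.rt_sub_le hle hw hwy hwy'
  have hr := h.rt_mono hle (hw.trans_le hwy')
  have e2 := max_sub_max_le_sub (θ := θ) hr
  have e3 : 0 ≤ max (rt P q y') θ - max (rt P q y) θ := sub_nonneg.2 (max_le_max_right θ hr)
  have hb := h.be_pos
  have hc := h.cc_pos
  have hy := sub_nonneg.2 hle
  rw [h.kern_sub hD' hD, abs_of_nonneg (by positivity)]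
  calc q * (max (rt P q y') θ - max (rt P q y) θ) /
        (dn P q (max (rt P q y') θ) * dn P q (max (rt P q y) θ))
      = q / (dn P q (max (rt P q y') θ) * dn P q (max (rt P q y) θ)) *
        (max (rt P q y') θ - max (rt P q y) θ) := by ring
    _ ≤ q / (d * d) * (2 * (P.b₂ - 1) / (w * w) * (2 * cc P * (y' - y))) :=
        div_mul_le_div_mul hq.le hd hdy' hdy e3 (e2.trans e1)
    _ ≤ S / (d * d) * (2 * (P.b₂ - 1) / (w * w) * (2 * cc P * (y' - y))) := by
        gcongr
    _ = _ := by ring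

theorem exists_kern_lipschitz (B : Box P u₁ T δ Λ) (h : Good P) {θ : ℝ} (hθ : lowRt P ≤ θ)
    (hθ1 : θ ≤ 1) : ∃ C, 0 ≤ C ∧ ∀ q y y', (q, y) ∈ strip P u₁ T δ Λ →
      (q, y') ∈ strip P u₁ T δ Λ → |kern P θ q y - kern P θ q y'| ≤ C * |y - y'| := by
  obtain ⟨w, hw0, hw⟩ := B.exists_le_nrt h
  obtain ⟨d, hd0, hd⟩ := B.exists_le_dn h hθ hθ1
  have hb := h.be_pos
  have hc := h.cc_pos
  have hT : 0 < T := by linarith [B.one_le_T h]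
  refine ⟨T / (d * d) * (2 * (P.b₂ - 1) / (w * w) * (2 * cc P)), by positivity, ?_⟩
  intro q y y' hy hy'
  have hq := B.fst_pos hy
  have hqT := hy.1.2
  have hwy := hw _ hy
  have hwy' := hw _ hy'
  have hdy := hd _ hy
  have hdy' := hd _ hy'
  rcases le_total y y' with hle | hle
  · rw [abs_sub_comm, abs_sub_comm y, abs_of_nonneg (sub_nonneg.2 hle)]
    exact h.kern_sub_le hq hqT hle hw0 hwy hwy' hd0 hdy hdy'
  · rw [abs_of_nonneg (sub_nonneg.2 hle)]
    exact h.kern_sub_le hq hqT hle hw0 hwy' hwy hd0 hdy' hdy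

theorem abs_cl_sub_le (q y y' : ℝ) : |cl P δ Λ q y - cl P δ Λ q y'| ≤ |y - y'| := by
  unfold cl
  refine (abs_max_sub_max_le_max _ _ _ _).trans ?_
  rw [sub_self, abs_zero]
  refine max_le (abs_nonneg _) ((abs_min_sub_min_le_max _ _ _ _).trans ?_)
  simp

end Box

/-! ### The cut-off flow and the cut-off cost. -/

variable (P)

/-- The integrand of the round-trip cost, cut off where `y ≤ sgn(1-R) m(q)`. -/
def cost (δ Λ q y : ℝ) : ℝ := P.R / q * kern P 1 q (cl P δ Λ q y)

/-- Solutions of the cut-off equation started on the curve `sgn(1-R) m`. -/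
def IsFlow (δ Λ u T : ℝ) (y : ℝ → ℝ) : Prop :=
  y u = sm P u ∧
    ∀ q ∈ Icc u T, HasDerivWithinAt y (fld P δ Λ q (y q)) (Icc u T) q

variable {P}

theorem _root_.HasDerivWithinAt.Ici_of_Icc {f : ℝ → ℝ} {f' a b t : ℝ}
    (h : HasDerivWithinAt f f' (Icc a b) t) (ht : t ∈ Ico a b) :
    HasDerivWithinAt f f' (Ici t) t :=
  h.mono_of_mem_nhdsWithin (mem_of_superset (Icc_mem_nhdsGE ht.2) (Icc_subset_Icc_left ht.1))

namespace Box

variable {u₁ T δ Λ : ℝ}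

theorem exists_strip_bound (B : Box P u₁ T δ Λ) (h : Good P) :
    ∃ C, 0 ≤ C ∧ ∀ z ∈ strip P u₁ T δ Λ, |z.2| ≤ C := by
  obtain ⟨C, hC⟩ := (B.isCompact_strip h).exists_bound_of_continuousOn
    (f := fun z : ℝ × ℝ => z.2) continuousOn_snd
  exact ⟨max C 0, le_max_right _ _, fun _ hz => (hC _ hz).trans (le_max_left _ _)⟩

theorem abs_sg (h : Good P) : |sg P| = 1 := by
  rcases h.sg_cases with ⟨-, h1, -⟩ | ⟨-, h1, -⟩ <;> rw [h1] <;> simp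

theorem abs_max_sg_le (h : Good P) (y : ℝ) : |max 0 (sg P * y)| ≤ |y| := by
  rw [abs_of_nonneg (le_max_left _ _)]
  refine max_le (abs_nonneg _) ((le_abs_self _).trans ?_)
  rw [abs_mul, abs_sg h, one_mul]

theorem abs_max_sg_sub_le (h : Good P) (y y' : ℝ) :
    |max 0 (sg P * y) - max 0 (sg P * y')| ≤ |y - y'| := by
  refine (abs_max_sub_max_le_max _ _ _ _).trans ?_
  rw [sub_self, abs_zero, ← mul_sub, abs_mul, abs_sg h, one_mul]
  simp

theorem exists_fld_bound (B : Box P u₁ T δ Λ) (h : Good P) :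
    ∃ C, 0 ≤ C ∧ ∀ q ∈ Icc u₁ T, ∀ y, |fld P δ Λ q y| ≤ C := by
  obtain ⟨C, hC0, hC⟩ := B.exists_strip_bound h
  obtain ⟨C', hC0', hC'⟩ := B.exists_kern_bound h le_rfl h.lowRt_lt.le
  have hr := h.ra_pos
  refine ⟨ra P * C * C', by positivity, fun q hq y => ?_⟩
  have hm := B.cl_mem hq y
  unfold fld
  rw [abs_neg, abs_mul, abs_mul, abs_of_pos hr]
  have := (abs_max_sg_le h (cl P δ Λ q y)).trans (hC _ hm)
  have := hC' _ hm
  dsimp only at this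
  gcongr

theorem exists_fld_lipschitz (B : Box P u₁ T δ Λ) (h : Good P) :
    ∃ K : NNReal, ∀ q ∈ Icc u₁ T, LipschitzWith K (fld P δ Λ q) := by
  obtain ⟨C, hC0, hC⟩ := B.exists_strip_bound h
  obtain ⟨C', hC0', hC'⟩ := B.exists_kern_bound h le_rfl h.lowRt_lt.le
  obtain ⟨L, hL0, hL⟩ := B.exists_kern_lipschitz h le_rfl h.lowRt_lt.le
  have hr := h.ra_pos
  refine ⟨⟨ra P * (C' + C * L), by positivity⟩, fun q hq => LipschitzWith.of_dist_le_mul ?_⟩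
  intro y y'
  have hm := B.cl_mem hq y
  have hm' := B.cl_mem hq y'
  have hcl := abs_cl_sub_le (P := P) (δ := δ) (Λ := Λ) q y y'
  rw [Real.dist_eq, Real.dist_eq]
  change _ ≤ ra P * (C' + C * L) * |y - y'|
  unfold fld
  set c := cl P δ Λ q y
  set c' := cl P δ Λ q y'
  have h1 := (abs_max_sg_sub_le h c c').trans hcl
  have h2 := (abs_max_sg_le h c').trans (hC _ hm')
  have h3 := (hL q c c' hm hm').trans (mul_le_mul_of_nonneg_left hcl hL0)
  have h4 := hC' _ hm
  dsimp only at h4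
  set n := max 0 (sg P * c)
  set n' := max 0 (sg P * c')
  set k := kern P (lowRt P) q c
  set k' := kern P (lowRt P) q c'
  have e : -(ra P * n * k) - -(ra P * n' * k') = -(ra P * ((n - n') * k + n' * (k - k'))) := by
    ring
  rw [e, abs_neg, abs_mul, abs_of_pos hr, mul_assoc]
  refine mul_le_mul_of_nonneg_left ?_ hr.le
  calc |(n - n') * k + n' * (k - k')| ≤ |n - n'| * |k| + |n'| * |k - k'| := by
        rw [← abs_mul, ← abs_mul]; exact abs_add_le _ _
    _ ≤ |y - y'| * C' + C * (L * |y - y'|) := by gcongr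
    _ = _ := by ring

theorem continuousOn_cl (B : Box P u₁ T δ Λ) (h : Good P) {s : Set ℝ} (hs : s ⊆ Icc u₁ T)
    {f : ℝ → ℝ} (hf : ContinuousOn f s) : ContinuousOn (fun q => cl P δ Λ q (f q)) s := by
  unfold cl
  exact continuousOn_const.sup (hf.inf ((B.continuousOn_hi h).mono hs))

theorem continuousOn_kern_cl (B : Box P u₁ T δ Λ) (h : Good P) {s : Set ℝ} (hs : s ⊆ Icc u₁ T)
    {f : ℝ → ℝ} (hf : ContinuousOn f s) {θ : ℝ} (hθ : lowRt P ≤ θ) (hθ1 : θ ≤ 1) :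
    ContinuousOn (fun q => kern P θ q (cl P δ Λ q (f q))) s :=
  ContinuousOn.comp (g := fun z : ℝ × ℝ => kern P θ z.1 z.2)
    (f := fun q => (q, cl P δ Λ q (f q))) (B.continuousOn_kern h hθ hθ1)
    (continuousOn_id.prodMk (B.continuousOn_cl h hs hf)) fun _ hq => B.cl_mem (hs hq) _

theorem continuousOn_fld (B : Box P u₁ T δ Λ) (h : Good P) {s : Set ℝ} (hs : s ⊆ Icc u₁ T)
    {f : ℝ → ℝ} (hf : ContinuousOn f s) : ContinuousOn (fun q => fld P δ Λ q (f q)) s := by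
  have h1 := B.continuousOn_cl h hs hf
  have h2 := B.continuousOn_kern_cl h hs hf le_rfl h.lowRt_lt.le
  unfold fld
  exact ((continuousOn_const.mul
    (continuousOn_const.sup (continuousOn_const.mul h1))).mul h2).neg

theorem exists_flow (B : Box P u₁ T δ Λ) (h : Good P) {u : ℝ} (hu : u ∈ Icc u₁ T) :
    ∃ y, IsFlow P δ Λ u T y := by
  obtain ⟨C, hC0, hC⟩ := B.exists_fld_bound h
  obtain ⟨K, hK⟩ := B.exists_fld_lipschitz h
  have hsub : Icc u T ⊆ Icc u₁ T := Icc_subset_Icc_left hu.1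
  have hT : 0 ≤ T - u := by linarith [hu.2]
  -- The field is bounded by `C` for all `y`, so the radius `C(T-u)` gives a solution on the whole
  -- interval at once.
  have hp : IsPicardLindelof (fun q y => fld P δ Λ q y) (tmin := u) (tmax := T)
      ⟨u, le_rfl, hu.2⟩ (sm P u) (⟨C, hC0⟩ * ⟨T - u, hT⟩) 0 ⟨C, hC0⟩ K :=
    { lipschitzOnWith := fun t ht => (hK t (hsub ht)).lipschitzOnWith
      continuousOn := fun x _ => B.continuousOn_fld h hsub continuousOn_const
      norm_le := fun t ht x _ => hC t (hsub ht) x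
      mul_max_le := by
        change C * max (T - u) (u - u) ≤ C * (T - u) - 0
        rw [sub_self, max_eq_left hT, sub_zero] }
  obtain ⟨y, hy, hy'⟩ := hp.exists_eq_forall_mem_Icc_hasDerivWithinAt₀
  exact ⟨y, hy, hy'⟩

theorem cl_sm (B : Box P u₁ T δ Λ) {q : ℝ} (hq : q ∈ Icc u₁ T) : cl P δ Λ q (sm P q) = sm P q :=
  B.cl_eq (B.lower q hq).le (B.le_hi q)

theorem cl_mono (B : Box P u₁ T δ Λ) (q : ℝ) {y y' : ℝ} (hy : y ≤ y') :
    cl P δ Λ q y ≤ cl P δ Λ q y' := by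
  have := B.Λ_pos
  unfold cl; gcongr

theorem nrt_cl_pos (B : Box P u₁ T δ Λ) (h : Good P) {q : ℝ} (hq : q ∈ Icc u₁ T) (y : ℝ) :
    0 < nrt P q (cl P δ Λ q y) := B.nrt_pos h (z := (q, cl P δ Λ q y)) (B.cl_mem hq y)

theorem kern_nonneg (B : Box P u₁ T δ Λ) (h : Good P) {q y θ : ℝ} (hq : q ∈ Icc u₁ T)
    (hθ : lowRt P ≤ θ) (hθ1 : θ ≤ 1) (hy : sm P q ≤ y) : 0 ≤ kern P θ q (cl P δ Λ q y) := by
  have hD := B.dn_pos h hθ hθ1 (B.cl_mem hq y)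
  have h1 := B.cl_mono q hy
  rw [B.cl_sm hq, ← h.one_le_rt_iff (B.nrt_cl_pos h hq y)] at h1
  exact div_nonneg (by linarith [le_max_left (rt P q (cl P δ Λ q y)) θ]) hD.le

theorem kern_nonpos (B : Box P u₁ T δ Λ) (h : Good P) {q y θ : ℝ} (hq : q ∈ Icc u₁ T)
    (hθ : lowRt P ≤ θ) (hθ1 : θ ≤ 1) (hy : y ≤ sm P q) : kern P θ q (cl P δ Λ q y) ≤ 0 := by
  have hD := B.dn_pos h hθ hθ1 (B.cl_mem hq y)
  have h1 := B.cl_mono q hy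
  rw [B.cl_sm hq, ← h.rt_le_one_iff (B.nrt_cl_pos h hq y)] at h1
  exact div_nonpos_of_nonpos_of_nonneg (by linarith [max_le h1 hθ1]) hD.le

theorem kern_pos (B : Box P u₁ T δ Λ) (h : Good P) {q y θ : ℝ} (hq : q ∈ Icc u₁ T)
    (hθ : lowRt P ≤ θ) (hθ1 : θ ≤ 1) (hy : sm P q < cl P δ Λ q y) :
    0 < kern P θ q (cl P δ Λ q y) := by
  have hD := B.dn_pos h hθ hθ1 (B.cl_mem hq y)
  rw [← not_le, ← h.rt_le_one_iff (B.nrt_cl_pos h hq y), not_le] at hy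
  exact div_pos (by linarith [le_max_left (rt P q (cl P δ Λ q y)) θ]) hD

theorem fld_nonpos (B : Box P u₁ T δ Λ) (h : Good P) {q y : ℝ} (hq : q ∈ Icc u₁ T)
    (hy : sm P q ≤ y) : fld P δ Λ q y ≤ 0 := by
  have := B.kern_nonneg h hq le_rfl h.lowRt_lt.le hy
  have := h.ra_pos
  have : 0 ≤ max 0 (sg P * cl P δ Λ q y) := le_max_left _ _
  unfold fld
  rw [neg_nonpos]; positivity

theorem fld_nonneg (B : Box P u₁ T δ Λ) (h : Good P) {q y : ℝ} (hq : q ∈ Icc u₁ T)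
    (hy : y ≤ sm P q) : 0 ≤ fld P δ Λ q y := by
  have := neg_nonneg.2 (B.kern_nonpos h hq le_rfl h.lowRt_lt.le hy)
  have := h.ra_pos
  have : 0 ≤ max 0 (sg P * cl P δ Λ q y) := le_max_left _ _
  unfold fld
  rw [← mul_neg]; positivity

theorem cost_nonneg (B : Box P u₁ T δ Λ) (h : Good P) {q : ℝ} (hq : q ∈ Icc u₁ T) (y : ℝ) :
    0 ≤ cost P δ Λ q y := by
  have hR := h.R_pos
  have hq0 := B.pos.trans_le hq.1
  have hD := B.dn_pos h h.lowRt_lt.le le_rfl (B.cl_mem hq y)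
  have : 0 ≤ kern P 1 q (cl P δ Λ q y) :=
    div_nonneg (by linarith [le_max_right (rt P q (cl P δ Λ q y)) 1]) hD.le
  unfold cost
  positivity

theorem cost_pos (B : Box P u₁ T δ Λ) (h : Good P) {q y : ℝ} (hq : q ∈ Icc u₁ T)
    (hy : sm P q < cl P δ Λ q y) : 0 < cost P δ Λ q y := by
  have hR := h.R_pos
  have hq0 := B.pos.trans_le hq.1
  have := B.kern_pos h hq h.lowRt_lt.le le_rfl hy
  unfold cost
  positivity

/-- Cutting `p` off at `1` removes all cost below the curve. This is what permits integrating to the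
fixed endpoint `T` instead of `ζ(u)`. -/
theorem cost_eq_zero (B : Box P u₁ T δ Λ) (h : Good P) {q y : ℝ} (hq : q ∈ Icc u₁ T)
    (hy : y ≤ sm P q) : cost P δ Λ q y = 0 := by
  have h1 := B.cl_mono q hy
  rw [B.cl_sm hq, ← h.rt_le_one_iff (B.nrt_cl_pos h hq y)] at h1
  unfold cost kern
  rw [max_eq_right h1]; simp

theorem cost_mono (B : Box P u₁ T δ Λ) (h : Good P) {q y y' : ℝ} (hq : q ∈ Icc u₁ T)
    (hy : y ≤ y') : cost P δ Λ q y ≤ cost P δ Λ q y' := by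
  have hR := h.R_pos
  have hq0 := B.pos.trans_le hq.1
  have := h.kern_mono hq0 (B.lt_sl (B.cl_mem hq y')) h.lowRt_lt.le le_rfl (B.cl_mono q hy)
  unfold cost
  gcongr

theorem exists_cost_bound (B : Box P u₁ T δ Λ) (h : Good P) :
    ∃ C, 0 ≤ C ∧ ∀ q ∈ Icc u₁ T, ∀ y, |cost P δ Λ q y| ≤ C := by
  obtain ⟨C, hC0, hC⟩ := B.exists_kern_bound h h.lowRt_lt.le le_rfl
  have hR := h.R_pos
  have hu := B.pos
  refine ⟨P.R / u₁ * C, by positivity, fun q hq y => ?_⟩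
  have hq0 := hu.trans_le hq.1
  have h1 := hC _ (B.cl_mem hq y)
  have h2 := hq.1
  unfold cost
  rw [abs_mul, abs_of_pos (by positivity : 0 < P.R / q)]
  dsimp only at h1
  gcongr

theorem exists_cost_lipschitz (B : Box P u₁ T δ Λ) (h : Good P) :
    ∃ C, 0 ≤ C ∧ ∀ q ∈ Icc u₁ T, ∀ y y', |cost P δ Λ q y - cost P δ Λ q y'| ≤ C * |y - y'| := by
  obtain ⟨C, hC0, hC⟩ := B.exists_kern_lipschitz h h.lowRt_lt.le le_rfl
  have hR := h.R_pos
  have hu := B.pos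
  refine ⟨P.R / u₁ * C, by positivity, fun q hq y y' => ?_⟩
  have hq0 := hu.trans_le hq.1
  have h1 := (hC _ _ _ (B.cl_mem hq y) (B.cl_mem hq y')).trans
    (mul_le_mul_of_nonneg_left (abs_cl_sub_le q y y') hC0)
  have h2 := hq.1
  unfold cost
  rw [← mul_sub, abs_mul, abs_of_pos (by positivity : 0 < P.R / q), mul_assoc]
  gcongr

theorem continuousOn_cost (B : Box P u₁ T δ Λ) (h : Good P) {s : Set ℝ} (hs : s ⊆ Icc u₁ T)
    {f : ℝ → ℝ} (hf : ContinuousOn f s) : ContinuousOn (fun q => cost P δ Λ q (f q)) s :=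
  (continuousOn_const.div continuousOn_id fun _ hq => (B.pos.trans_le (hs hq).1).ne').mul
    (B.continuousOn_kern_cl h hs hf h.lowRt_lt.le le_rfl)

end Box

/-! ### Choice of the cut-off constants. -/

namespace Good

/-- For `R < 1`, `L` lies above its chord on `[0,1]`, since the difference is an explicit sum of
nonnegative terms. As `L(0) = 1`, positivity of `ℓ(1)` spreads to all of `[0,1]`. -/
theorem sl_ge (h : Good P) (hR1 : P.R < 1) {q : ℝ} (hq0 : 0 ≤ q) (hq1 : q ≤ 1) :
    (1 - q) + q * sl P 1 ≤ sl P q := by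
  have hA := h.lin_pos hq0 hq1
  obtain ⟨-, hs, hr⟩ | ⟨h', -⟩ := h.sg_cases
  swap
  · linarith
  have hb := h.b₁_pos
  have he : sl P q - ((1 - q) + q * sl P 1) = ra P / P.b₁ *
      ((1 - P.R) * (q * (1 - q)) +
        (P.b₂ - 1) * P.R * q * ((1 - P.R) * (1 - q) / lin P q)) := by
    have h1 : lin P 1 = 1 := by unfold lin; ring
    unfold sl
    rw [h1]
    unfold sm
    rw [hs]
    field_simp
    unfold lin
    ring
  have h1 := h.be_pos
  have h2 := h.R_pos
  have h3 := h.ra_pos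
  have h4 := sub_pos.2 hR1
  have h5 := sub_nonneg.2 hq1
  have : 0 ≤ ra P / P.b₁ *
      ((1 - P.R) * (q * (1 - q)) +
        (P.b₂ - 1) * P.R * q * ((1 - P.R) * (1 - q) / lin P q)) := by positivity
  linarith

theorem sl_pos (h : Good P) (hR1 : P.R < 1) {q : ℝ} (hq0 : 0 ≤ q) (hq1 : q ≤ 1) :
    0 < sl P q := by
  have h1 := h.sl_ge hR1 hq0 hq1
  have h2 : 0 < sl P 1 := by
    rw [h.sl_eq]
    obtain ⟨-, hs, -⟩ | ⟨h', -⟩ := h.sg_cases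
    · rw [hs, one_mul]; exact h.ell_pos hR1
    · linarith
  rcases hq0.eq_or_lt with rfl | hq
  · linarith
  · nlinarith [mul_pos hq h2]

theorem exists_box (h : Good P) {u₁ T : ℝ} (hu : 0 < u₁) (hu1 : u₁ < 1) (hT : 2 * qM P + 1 ≤ T) :
    ∃ δ Λ, Box P u₁ T δ Λ := by
  have hlin : ∀ q ∈ Icc u₁ 1, 0 < lin P q := fun q hq => h.lin_pos (hu.le.trans hq.1) hq.2
  have hlc : ContinuousOn (lin P) (Icc u₁ 1) := by unfold lin; fun_prop
  have hslc : ContinuousOn (sl P) (Icc u₁ 1) := fun q hq =>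
    (hasDerivAt_sl (hlin q hq).ne').continuousAt.continuousWithinAt
  have hne : (Icc u₁ 1).Nonempty := ⟨1, hu1.le, le_rfl⟩
  obtain ⟨l₀, hl₀, hgap⟩ : ∃ l₀, 0 < l₀ ∧ ∀ q ∈ Icc u₁ 1, l₀ ≤ sl P q - sm P q := by
    obtain ⟨z, hz, hm⟩ := isCompact_Icc.exists_isMinOn hne
      (hslc.sub continuous_sm.continuousOn)
    exact ⟨_, sub_pos.2 (h.sm_lt_sl (hu.trans_le hz.1) hz.2), fun q hq => isMinOn_iff.1 hm q hq⟩
  obtain ⟨e₀, he₀, htop⟩ : ∃ e₀, 0 < e₀ ∧ (P.R < 1 → ∀ q ∈ Icc u₁ 1, e₀ ≤ sl P q) := by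
    by_cases hR : P.R < 1
    · obtain ⟨z, hz, hm⟩ := isCompact_Icc.exists_isMinOn hne hslc
      exact ⟨_, h.sl_pos hR (hu.le.trans hz.1) hz.2, fun _ q hq => isMinOn_iff.1 hm q hq⟩
    · exact ⟨1, one_pos, fun h' => absurd h' hR⟩
  obtain ⟨C, hC⟩ : ∃ C, ∀ q ∈ Icc u₁ 1, ‖slDeriv P q‖ ≤ C := by
    refine isCompact_Icc.exists_bound_of_continuousOn ?_
    unfold slDeriv smDeriv
    have h1 : ∀ q ∈ Icc u₁ 1, lin P q ^ 2 ≠ 0 := fun q hq => by have := hlin q hq; positivity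
    have h2 : ContinuousOn (fun q => P.R / lin P q ^ 2) (Icc u₁ 1) :=
      continuousOn_const.div (hlc.pow 2) h1
    fun_prop
  obtain ⟨a, ha⟩ : ∃ a, ∀ q ∈ Icc u₁ 1, ‖lin P q‖ ≤ a :=
    isCompact_Icc.exists_bound_of_continuousOn hlc
  obtain ⟨Λ', hΛ'⟩ : ∃ C, ∀ q ∈ Icc u₁ T, ‖sm P q‖ ≤ C :=
    isCompact_Icc.exists_bound_of_continuousOn continuous_sm.continuousOn
  have hra := h.ra_pos
  have ha0 : 0 < a := (hlin 1 ⟨hu1.le, le_rfl⟩).trans_le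
    ((le_abs_self _).trans (ha 1 ⟨hu1.le, le_rfl⟩))
  have hC0 : 0 ≤ C := (norm_nonneg _).trans (hC 1 ⟨hu1.le, le_rfl⟩)
  -- `ν` bounds `n` from below in the band just under `L`: by `e₀/2` when `R < 1`, by `1` when `R >
  -- 1`.
  set ν := min 1 (e₀ / 2) with hν
  have hν0 : 0 < ν := lt_min one_pos (by linarith)
  -- The first two bounds keep the band away from `M` and, for `R < 1`, from `0`. The third makes
  -- the drift in the band at least `C + 1`, which exceeds the maximal speed `C` of `L`.
  set δ := min (min (l₀ / 4) (e₀ / 4)) (ra P * ν * l₀ / (4 * a * (C + 1))) with hδ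
  have hδ0 : 0 < δ := lt_min (lt_min (by linarith) (by linarith)) (by positivity)
  have hδ1 : 4 * δ ≤ l₀ := by
    have : δ ≤ l₀ / 4 := (min_le_left _ _).trans (min_le_left _ _)
    linarith
  have hδ2 : 4 * δ ≤ e₀ := by
    have : δ ≤ e₀ / 4 := (min_le_left _ _).trans (min_le_right _ _)
    linarith
  have hδ3 : (C + 1) ≤ ra P * ν * (l₀ / (4 * a * δ)) := by
    have : δ ≤ ra P * ν * l₀ / (4 * a * (C + 1)) := min_le_right _ _
    rw [le_div_iff₀ (by positivity)] at this
    rw [mul_div_assoc', le_div_iff₀ (by positivity)]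
    linarith
  refine ⟨δ, max Λ' 0 + 1, hu, hu1, hT, hδ0, by positivity,
    fun q hq => hδ1.trans (hgap q hq), ?_, ?_, ?_⟩
  · intro q hq
    have := neg_abs_le (sm P q)
    have h1 : |sm P q| ≤ Λ' := hΛ' q hq
    linarith [le_max_left Λ' 0]
  · intro hR q hq
    linarith [htop hR q hq]
  · intro q hq y hy hy1
    have hn : ν ≤ sg P * y := by
      rcases h.sg_cases with ⟨hR, hs, -⟩ | ⟨hR, hs, -⟩ <;> rw [hs]
      · have := htop hR q hq
        have := min_le_right 1 (e₀ / 2)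
        linarith [hy.1]
      · have := hy1 hR
        have := min_le_left 1 (e₀ / 2)
        linarith
    have hA := hlin q hq
    have hAa : lin P q ≤ a := (le_abs_self _).trans (ha q hq)
    have hg : 0 < sl P q - y := by linarith [hy.2]
    have hg2 : sl P q - y ≤ 2 * δ := by linarith [hy.1]
    have hd : l₀ / 2 ≤ y - sm P q := by linarith [hy.1, hgap q hq]
    have hk : l₀ / (4 * a * δ) ≤ (y - sm P q) / (lin P q * (sl P q - y)) := by
      calc l₀ / (4 * a * δ) = (l₀ / 2) / (a * (2 * δ)) := by field_simp; norm_num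
        _ ≤ _ := by
          have : 0 ≤ y - sm P q := by linarith
          gcongr
    have hs : -C ≤ slDeriv P q := (abs_le.1 (hC q hq)).1
    have : ra P * ν * (l₀ / (4 * a * δ)) ≤
        ra P * (sg P * y) * ((y - sm P q) / (lin P q * (sl P q - y))) := by
      have := hν0.le.trans hn
      gcongr
    linarith

end Good

/-! ### Comparison principle and shape of the trajectories. -/

/-- A function which starts nonnegative and increases wherever it is nonpositive
becomes positive. -/
theorem _root_.pos_of_deriv_pos {f f' : ℝ → ℝ} {a b : ℝ} (hab : a < b)
    (hf : ∀ t ∈ Icc a b, HasDerivWithinAt f (f' t) (Icc a b) t) (h0 : 0 ≤ f a)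
    (h : ∀ t ∈ Ioc a b, f t ≤ 0 → 0 < f' t) : 0 < f b := by
  by_contra! hb
  have hc : ContinuousOn f (Icc a b) := fun t ht => (hf t ht).continuousWithinAt
  obtain ⟨t, ht, hmin⟩ : ∃ t ∈ Ioc a b, ∀ s ∈ Icc a b, f t ≤ f s := by
    obtain ⟨t, ht, hmin⟩ := isCompact_Icc.exists_isMinOn ⟨a, le_rfl, hab.le⟩ hc
    rcases ht.1.eq_or_lt with rfl | hat
    -- A minimum at `a` is also attained at `b`, because `f b ≤ 0 ≤ f a`. So a minimiser with room
    -- on its left always exists.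
    · exact ⟨b, ⟨hab, le_rfl⟩, fun s hs => hb.trans (h0.trans (isMinOn_iff.1 hmin s hs))⟩
    · exact ⟨t, ⟨hat, ht.2⟩, fun s hs => isMinOn_iff.1 hmin s hs⟩
  have hd := h t ht ((hmin b ⟨hab.le, le_rfl⟩).trans hb)
  have h1 : HasDerivWithinAt f (f' t) (Iio t) t :=
    (hf t ⟨ht.1.le, ht.2⟩).mono_of_mem_nhdsWithin
      (mem_of_superset (Ioo_mem_nhdsLT ht.1) fun s hs => ⟨hs.1.le, hs.2.le.trans ht.2⟩)
  rw [hasDerivWithinAt_iff_tendsto_slope' self_notMem_Iio] at h1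
  refine hd.not_ge (le_of_tendsto h1 ?_)
  filter_upwards [Ioo_mem_nhdsLT ht.1] with s hs
  rw [slope_def_field]
  exact div_nonpos_of_nonneg_of_nonpos
    (sub_nonneg.2 (hmin s ⟨hs.1.le, hs.2.le.trans ht.2⟩)) (by linarith [hs.2])

namespace IsFlow

variable {u₁ T δ Λ u : ℝ} {y : ℝ → ℝ}

theorem continuousOn (hy : IsFlow P δ Λ u T y) : ContinuousOn y (Icc u T) :=
  fun q hq => (hy.2 q hq).continuousWithinAt

theorem hasDerivWithinAt_sub (hy : IsFlow P δ Λ u T y) {a b : ℝ} (ha : u ≤ a) (hb : b ≤ T)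
    {q : ℝ} (hq : q ∈ Icc a b) : HasDerivWithinAt (fun q => y q - sm P q)
      (fld P δ Λ q (y q) - smDeriv P q) (Icc a b) q :=
  ((hy.2 q ⟨ha.trans hq.1, hq.2.trans hb⟩).mono (Icc_subset_Icc ha hb)).sub
    (hasDerivAt_sm q).hasDerivWithinAt

theorem smDeriv_neg (h : Good P) {q : ℝ} (hq : q < qM P) : smDeriv P q < 0 := by
  rw [h.smDeriv_eq]
  exact mul_neg_of_pos_of_neg
    (mul_pos (mul_pos two_pos h.R_pos) (div_pos h.ra_pos h.b₁_pos)) (by linarith)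

theorem smDeriv_pos (h : Good P) {q : ℝ} (hq : qM P < q) : 0 < smDeriv P q := by
  rw [h.smDeriv_eq]
  exact mul_pos (mul_pos (mul_pos two_pos h.R_pos) (div_pos h.ra_pos h.b₁_pos)) (by linarith)

theorem qM_lt (B : Box P u₁ T δ Λ) (h : Good P) : qM P < T := by
  linarith [B.le_T, h.qM_pos]

/-- Before `q_M` the solution stays strictly above the curve. -/
theorem sm_lt (hy : IsFlow P δ Λ u T y) (B : Box P u₁ T δ Λ) (h : Good P) (hu : u₁ ≤ u) {q : ℝ}
    (hq : q ∈ Ioo u (qM P)) : sm P q < y q := by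
  have hqT : q ≤ T := hq.2.le.trans (qM_lt B h).le
  refine sub_pos.1 (pos_of_deriv_pos (f := fun q => y q - sm P q) hq.1
    (fun t ht => hy.hasDerivWithinAt_sub le_rfl hqT ht) (by simp [hy.1]) fun t ht h0 => ?_)
  have h1 := B.fld_nonneg h ⟨hu.trans ht.1.le, ht.2.trans hqT⟩ (sub_nonpos.1 h0)
  have h2 := smDeriv_neg h (ht.2.trans_lt hq.2)
  linarith

theorem sm_le (hy : IsFlow P δ Λ u T y) (B : Box P u₁ T δ Λ) (h : Good P) (hu : u₁ ≤ u) {q : ℝ}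
    (hq : q ∈ Icc u (qM P)) : sm P q ≤ y q := by
  rcases hq.1.eq_or_lt with rfl | hq1
  · exact hy.1.ge
  have hc : ContinuousOn (fun q => y q - sm P q) (Icc u (qM P)) :=
    (hy.continuousOn.sub continuous_sm.continuousOn).mono (Icc_subset_Icc_right (qM_lt B h).le)
  have hlt : u < qM P := hq1.trans_le hq.2
  have := ContinuousWithinAt.closure_le (s := Ioo u (qM P)) (f := fun _ : ℝ => (0 : ℝ))
    (x := q) (by rwa [closure_Ioo hlt.ne]) continuousWithinAt_const
    ((hc q hq).mono Ioo_subset_Icc_self)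
    (fun t ht => sub_nonneg.2 (hy.sm_lt B h hu ht).le)
  exact sub_nonneg.1 this

/-- After `q_M`, once below the curve the solution remains strictly below. -/
theorem lt_sm (hy : IsFlow P δ Λ u T y) (B : Box P u₁ T δ Λ) (h : Good P) (hu : u₁ ≤ u) {a q : ℝ}
    (hua : u ≤ a) (ha : qM P ≤ a) (haq : a < q) (hqT : q ≤ T) (h0 : y a ≤ sm P a) :
    y q < sm P q := by
  refine sub_pos.1 (pos_of_deriv_pos (f := fun q => sm P q - y q)
    (f' := fun q => -(fld P δ Λ q (y q) - smDeriv P q)) haq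
    (fun t ht => ?_) (sub_nonneg.2 h0) fun t ht ht0 => ?_)
  · have := (hy.hasDerivWithinAt_sub hua hqT ht).neg
    refine this.congr_of_mem (fun s _ => ?_) ht
    simp
  · have h1 := B.fld_nonpos h ⟨(hu.trans hua).trans ht.1.le, ht.2.trans hqT⟩ (sub_nonpos.1 ht0)
    have h2 := smDeriv_pos h (ha.trans_lt ht.1)
    linarith

theorem antitoneOn (hy : IsFlow P δ Λ u T y) (B : Box P u₁ T δ Λ) (h : Good P) (hu : u₁ ≤ u)
    {z : ℝ} (hz : z ≤ T) (hs : ∀ q ∈ Icc u z, sm P q ≤ y q) : AntitoneOn y (Icc u z) := by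
  have hsub : Icc u z ⊆ Icc u T := Icc_subset_Icc_right hz
  refine antitoneOn_of_hasDerivWithinAt_nonpos (convex_Icc _ _) (hy.continuousOn.mono hsub)
    (f' := fun q => fld P δ Λ q (y q)) (fun q hq => ?_) fun q hq => ?_
  · exact (hy.2 q (hsub (interior_subset hq))).mono (interior_subset.trans hsub)
  · have hq' := interior_subset hq
    exact B.fld_nonpos h ⟨hu.trans hq'.1, hq'.2.trans hz⟩ (hs q hq')

/-- The point at which the solution crosses the curve. -/
theorem exists_crossing (hy : IsFlow P δ Λ u T y) (B : Box P u₁ T δ Λ) (h : Good P)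
    (hu : u₁ ≤ u) (huM : u ≤ qM P) :
    ∃ ζ ∈ Icc (qM P) (2 * qM P - u), y ζ = sm P ζ ∧ (∀ q ∈ Icc u ζ, sm P q ≤ y q) ∧
      (∀ q ∈ Ioc ζ T, y q < sm P q) := by
  have hu0 := B.pos.trans_le hu
  set e := 2 * qM P - u with he
  have heM : qM P ≤ e := by linarith
  have heT : e ≤ T := by linarith [B.le_T]
  have hc : ContinuousOn (fun q => y q - sm P q) (Icc (qM P) e) :=
    (hy.continuousOn.sub continuous_sm.continuousOn).mono (Icc_subset_Icc huM heT)
  -- Were `y` still above `M` at the mirror point `e`, it would have been above all along, hence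
  -- nonincreasing. Then `y e ≤ M(u) = M(e)`, a contradiction.
  have hend : y e ≤ sm P e := by
    by_contra! hlt
    have hs : ∀ q ∈ Icc u e, sm P q ≤ y q := by
      intro q hq
      rcases le_total q (qM P) with hqM | hqM
      · exact hy.sm_le B h hu ⟨hq.1, hqM⟩
      · by_contra! hlt'
        rcases hq.2.eq_or_lt with rfl | hqe
        · exact hlt.not_gt hlt'
        · exact hlt.not_gt (hy.lt_sm B h hu hq.1 hqM hqe heT hlt'.le)
    have h1 := hy.antitoneOn B h hu heT hs ⟨le_rfl, huM.trans heM⟩ ⟨huM.trans heM, le_rfl⟩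
      (huM.trans heM)
    rw [hy.1, ← h.sm_symm u] at h1
    exact hlt.not_ge h1
  obtain ⟨ζ, hζ, hζ0⟩ := intermediate_value_Icc' heM hc
    (show (0 : ℝ) ∈ Icc _ _ from ⟨sub_nonpos.2 hend, sub_nonneg.2 (hy.sm_le B h hu ⟨huM, le_rfl⟩)⟩)
  have hζ1 : y ζ = sm P ζ := sub_eq_zero.1 hζ0
  refine ⟨ζ, hζ, hζ1, fun q hq => ?_, fun q hq =>
    hy.lt_sm B h hu (huM.trans hζ.1) hζ.1 hq.1 hq.2 hζ1.le⟩
  rcases le_total q (qM P) with hqM | hqM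
  · exact hy.sm_le B h hu ⟨hq.1, hqM⟩
  · by_contra! hlt'
    rcases hq.2.eq_or_lt with rfl | hqe
    · exact hζ1.not_lt hlt'
    · exact (hy.lt_sm B h hu hq.1 hqM hqe (hζ.2.trans heT) hlt'.le).ne hζ1

theorem fld_eq_zero (B : Box P u₁ T δ Λ) (h : Good P) (hR : P.R < 1) {t w : ℝ} (hw : w ≤ 0) :
    fld P δ Λ t w = 0 := by
  have hs : sg P = 1 := by
    rcases h.sg_cases with ⟨-, h1, -⟩ | ⟨h1, -⟩
    · exact h1
    · linarith
  have : cl P δ Λ t w ≤ 0 := max_le (neg_nonpos.2 B.Λ_pos.le) ((min_le_left _ _).trans hw)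
  unfold fld
  rw [hs, one_mul, max_eq_left this]; simp

/-- For `R < 1` the field vanishes on `y ≤ 0`, so zero cannot be crossed downwards. The strict
comparison principle is applied after adding an arbitrarily small linear tilt. -/
theorem nonneg (hy : IsFlow P δ Λ u T y) (B : Box P u₁ T δ Λ) (h : Good P) (hR : P.R < 1)
    (h0 : 0 ≤ sm P u) {q : ℝ} (hq : q ∈ Icc u T) : 0 ≤ y q := by
  rcases hq.1.eq_or_lt with rfl | hlt
  · rw [hy.1]; exact h0
  refine le_of_forall_pos_le_add fun ε hε => ?_
  have hε' : 0 < ε / (q - u) := div_pos hε (sub_pos.2 hlt)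
  have := pos_of_deriv_pos (f := fun t => y t + ε / (q - u) * (t - u))
    (f' := fun t => fld P δ Λ t (y t) + ε / (q - u) * 1) hlt (fun t ht => ?_) ?_ fun t ht ht0 => ?_
  · have e : ε / (q - u) * (q - u) = ε := div_mul_cancel₀ _ (sub_pos.2 hlt).ne'
    simp only [e] at this
    exact this.le
  · exact ((hy.2 t ⟨ht.1, ht.2.trans hq.2⟩).mono (Icc_subset_Icc_right hq.2)).add
      (((hasDerivAt_id t).sub_const u).const_mul _).hasDerivWithinAt
  · simp [hy.1, h0]
  · have : 0 ≤ ε / (q - u) * (t - u) := mul_nonneg hε'.le (by linarith [ht.1])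
    rw [fld_eq_zero B h hR (by linarith)]
    linarith

theorem sm_zero : sm P 0 = sg P := by unfold sm; ring

/-- For `R > 1` one has `M(0) = -1` and `M` decreases up to `q_M`, so the solution starts at or
below `-1` and then decreases. In the original variable this is `n ≥ 1`. -/
theorem le_neg_one (hy : IsFlow P δ Λ u T y) (B : Box P u₁ T δ Λ) (h : Good P) (hR : 1 < P.R)
    (hu : u₁ ≤ u) (huM : u ≤ qM P) {z : ℝ} (hz : z ≤ T) (hs : ∀ q ∈ Icc u z, sm P q ≤ y q) {q : ℝ}
    (hq : q ∈ Icc u z) : y q ≤ -1 := by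
  have h1 := hy.antitoneOn B h hu hz hs ⟨le_rfl, hq.1.trans hq.2⟩ hq hq.1
  have h2 := h.sm_anti (B.pos.trans_le hu).le huM
  rw [sm_zero] at h2
  rw [hy.1] at h1
  rcases h.sg_cases with ⟨h3, -⟩ | ⟨-, h3, -⟩ <;> linarith

/-- The solution stays away from `sgn(1-R) ℓ`. -/
theorem le_sl (hy : IsFlow P δ Λ u T y) (B : Box P u₁ T δ Λ) (h : Good P)
    (hu : u₁ ≤ u) (huM : u ≤ qM P) {z : ℝ} (hz : z ≤ T) (hs : ∀ q ∈ Icc u z, sm P q ≤ y q) {q : ℝ}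
    (hq : q ∈ Icc u z) : y q ≤ sl P (min q 1) - 2 * δ := by
  have hu0 := B.pos.trans_le hu
  have hδ := B.δ_pos
  have key : ∀ q ∈ Icc u z, q ≤ 1 → y q ≤ sl P q - 2 * δ := by
    intro q hq hq1
    rcases hq.1.eq_or_lt with rfl | hlt
    · rw [hy.1]; linarith [B.gap u ⟨hu, hq1⟩]
    have hsub : Icc u q ⊆ Icc u T := Icc_subset_Icc_right (hq.2.trans hz)
    have := pos_of_deriv_pos (f := fun t => sl P t - 2 * δ - y t)
      (f' := fun t => slDeriv P t - fld P δ Λ t (y t)) hlt (fun t ht => ?_) ?_ fun t ht ht0 => ?_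
    · linarith
    · have hA := h.lin_pos (hu0.le.trans ht.1) (ht.2.trans hq1)
      exact ((hasDerivAt_sl hA.ne').sub_const (2 * δ)).hasDerivWithinAt.sub
        ((hy.2 t (hsub ht)).mono hsub)
    · simp only [hy.1]
      linarith [B.gap u ⟨hu, hlt.le.trans hq1⟩]
    · have htu : u₁ ≤ t := hu.trans ht.1.le
      have ht1 : t ≤ 1 := ht.2.trans hq1
      have htz : t ∈ Icc u z := ⟨ht.1.le, ht.2.trans hq.2⟩
      have htT : t ∈ Icc u₁ T := ⟨htu, htz.2.trans hz⟩
      have hcm := B.cl_mem htT (y t)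
      have hge : sm P t ≤ cl P δ Λ t (y t) := by
        rw [← B.cl_sm htT]; exact B.cl_mono t (hs t htz)
      have hle : cl P δ Λ t (y t) ≤ sl P t - δ := by
        rw [← B.hi_eq ⟨htu, ht1⟩]; exact hcm.2.2
      -- Even if `y` has passed the cut-off level, its projection lies in the band where the
      -- `barrier` inequality holds. The comparison therefore needs no prior bound on `y`.
      have hge2 : sl P t - 2 * δ ≤ cl P δ Λ t (y t) := by
        refine le_max_of_le_right (le_min (by linarith) ?_)
        rw [B.hi_eq ⟨htu, ht1⟩]; linarith
      have hle2 : 1 < P.R → cl P δ Λ t (y t) ≤ -1 := by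
        intro hR
        have h1 := hy.le_neg_one B h hR hu huM hz hs htz
        have h2 := B.lower t htT
        exact max_le (by linarith [hs t htz]) ((min_le_left _ _).trans h1)
      have hb := B.barrier t ⟨htu, ht1⟩ _ ⟨hge2, hle⟩ hle2
      have hn := B.nrt_cl_pos h htT (y t)
      change 0 < slDeriv P t - fld P δ Λ t (y t)
      unfold fld
      generalize cl P δ Λ t (y t) = c at *
      have hlt : c < sl P t := by linarith
      have hd := h.drift_ge (hu0.trans ht.1) ht1 hn hge hlt
      have hk : kern P (lowRt P) t c = (rt P t c - 1) / dn P t (rt P t c) := by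
        unfold kern
        rw [max_eq_left (h.lowRt_lt.le.trans ((h.one_le_rt_iff hn).2 hge))]
      have hA := h.lin_pos (hu0.trans ht.1).le ht1
      have hd0 : 0 ≤ (c - sm P t) / (lin P t * (sl P t - c)) :=
        div_nonneg (sub_nonneg.2 hge) (mul_pos hA (sub_pos.2 hlt)).le
      rw [hk]
      have h1 : ra P * (sg P * c) * ((c - sm P t) / (lin P t * (sl P t - c))) ≤
          ra P * max 0 (sg P * c) * ((rt P t c - 1) / dn P t (rt P t c)) := by
        have := h.ra_pos
        have : sg P * c ≤ max 0 (sg P * c) := le_max_right _ _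
        have : 0 ≤ max 0 (sg P * c) := le_max_left _ _
        gcongr
      linarith
  rcases le_or_gt q 1 with hq1 | hq1
  · rw [min_eq_left hq1]; exact key q hq hq1
  · rw [min_eq_right hq1.le]
    have hanti := hy.antitoneOn B h hu hz hs
    rcases le_or_gt u 1 with hu1 | hu1
    · have h1 : (1 : ℝ) ∈ Icc u z := ⟨hu1, hq1.le.trans hq.2⟩
      exact (hanti h1 hq hq1.le).trans (key 1 h1 le_rfl)
    · have h1 := hanti ⟨le_rfl, hq.1.trans hq.2⟩ hq hq.1
      rw [hy.1] at h1
      have h2 := h.sm_anti hu1.le huM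
      linarith [B.gap 1 ⟨B.lt_one.le, le_rfl⟩]

/-! ### Return to the original equation. -/

/-- Where the cut-off is not active, the cut-off equation is the original one. -/
theorem regular_and_O_eq (B : Box P u₁ T δ Λ) (h : Good P) {q w : ℝ} (hq : q ∈ Icc u₁ T)
    (h1 : -Λ ≤ w) (h2 : w ≤ hi P δ q) (h3 : 0 ≤ sg P * w) (h4 : lowRt P ≤ rt P q w) :
    Regular P q (sg P * w) ∧ O P q (sg P * w) = sg P * fld P δ Λ q w := by
  have hcl := B.cl_eq (q := q) h1 h2
  have hmem := B.cl_mem hq w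
  rw [hcl] at hmem
  have hn := B.nrt_pos h (z := (q, w)) hmem
  have hD := B.dn_pos h (z := (q, w)) le_rfl h.lowRt_lt.le hmem
  dsimp only at hn hD
  rw [max_eq_left h4] at hD
  refine ⟨h.regular_iff.2 ⟨B.pos.trans_le hq.1, h3, B.lt_sl (z := (q, w)) hmem, hD.ne'⟩, ?_⟩
  rw [h.O_eq hn hD.ne', fld, hcl, max_eq_right h3, slope, kern, max_eq_left h4, ← h.sg_mul_ra]
  ring

theorem one_le_rt (B : Box P u₁ T δ Λ) (h : Good P) {q w : ℝ} (hq : q ∈ Icc u₁ T)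
    (h2 : w ≤ hi P δ q) (h1 : sm P q ≤ w) : 1 ≤ rt P q w := by
  have hmem := B.cl_mem hq w
  rw [B.cl_eq (q := q) ((B.lower q hq).le.trans h1) h2] at hmem
  exact (h.one_le_rt_iff (B.nrt_pos h (z := (q, w)) hmem)).2 h1

theorem sg_nonneg (hy : IsFlow P δ Λ u T y) (B : Box P u₁ T δ Λ) (h : Good P)
    (hu : u₁ ≤ u) (huM : u ≤ qM P) (h0 : 0 ≤ sg P * sm P u) {z : ℝ} (hz : z ≤ T)
    (hs : ∀ q ∈ Icc u z, sm P q ≤ y q) {q : ℝ} (hq : q ∈ Icc u z) : 0 ≤ sg P * y q := by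
  rcases h.sg_cases with ⟨hR, h1, -⟩ | ⟨hR, h1, -⟩
  · rw [h1, one_mul] at h0 ⊢
    exact hy.nonneg B h hR h0 ⟨hq.1, hq.2.trans hz⟩
  · have := hy.le_neg_one B h hR hu huM hz hs hq
    rw [h1]; linarith

theorem lt_hi_of_le_sl (B : Box P u₁ T δ Λ) {q w : ℝ} (hw : w ≤ sl P (min q 1) - 2 * δ) :
    w < hi P δ q :=
  lt_max_of_lt_left (by linarith [B.δ_pos])

/-- The solution of the cut-off equation solves the original one up to some point
beyond the crossing. -/
theorem exists_isSolution (hy : IsFlow P δ Λ u T y) (B : Box P u₁ T δ Λ) (h : Good P)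
    (hu : u₁ ≤ u) (huM : u ≤ qM P) (h0 : 0 ≤ sg P * sm P u) {ζ : ℝ}
    (hζ : ζ ∈ Icc (qM P) (2 * qM P - u)) (hζ1 : y ζ = sm P ζ)
    (hs : ∀ q ∈ Icc u ζ, sm P q ≤ y q) :
    ∃ z ∈ Ioc ζ T, IsSolution P u z (fun q => sg P * y q) := by
  have hu0 := B.pos.trans_le hu
  have huζ : u ≤ ζ := huM.trans hζ.1
  have hζT : ζ < T := by linarith [B.le_T, hζ.2]
  have hζm : ζ ∈ Icc u₁ T := ⟨hu.trans huζ, hζT.le⟩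
  have hs0 := fun q hq => hy.sg_nonneg B h hu huM h0 hζT.le hs (q := q) hq
  have hlt := lt_hi_of_le_sl B (hy.le_sl B h hu huM hζT.le hs ⟨huζ, le_rfl⟩)
  have hyc : ContinuousWithinAt y (Icc u T) ζ := hy.continuousOn ζ ⟨huζ, hζT.le⟩
  have hyc' : ContinuousWithinAt y (Ici ζ) ζ := hyc.mono_of_mem_nhdsWithin
    (mem_of_superset (Icc_mem_nhdsGE hζT) (Icc_subset_Icc_left huζ))
  have hhc : ContinuousWithinAt (hi P δ) (Ici ζ) ζ :=
    (B.continuousOn_hi h ζ hζm).mono_of_mem_nhdsWithin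
      (mem_of_superset (Icc_mem_nhdsGE hζT) (Icc_subset_Icc_left hζm.1))
  -- The cut-off constraints hold strictly at `ζ`, where `p = 1`, so they persist slightly to its
  -- right. Only nonnegativity for `R < 1` may be an equality at `ζ`; there it comes from `nonneg`.
  have e1 : ∀ᶠ q in 𝓝[≥] ζ, -Λ < y q :=
    hyc'.eventually_const_lt (by rw [hζ1]; exact B.lower ζ hζm)
  have e2 : ∀ᶠ q in 𝓝[≥] ζ, y q < hi P δ q := hyc'.eventually_lt hhc hlt
  have e3 : ∀ᶠ q in 𝓝[≥] ζ, q ∈ Icc ζ T → 0 ≤ sg P * y q := by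
    rcases h.sg_cases with ⟨hR, h1, -⟩ | ⟨hR, h1, -⟩
    · refine Eventually.of_forall fun q hq => ?_
      rw [h1, one_mul] at h0 ⊢
      exact hy.nonneg B h hR h0 ⟨huζ.trans hq.1, hq.2⟩
    · have := hy.le_neg_one B h hR hu huM hζT.le hs ⟨huζ, le_rfl⟩
      filter_upwards [hyc'.eventually_lt_const (by linarith : y ζ < 0)] with q hq _
      rw [h1]; linarith
  have e4 : ∀ᶠ q in 𝓝[≥] ζ, lowRt P < rt P q (y q) := by
    have hmem := B.cl_mem hζm (y ζ)
    rw [B.cl_eq (q := ζ) (by rw [hζ1]; exact (B.lower ζ hζm).le) hlt.le] at hmem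
    have hn := B.nrt_pos h (z := (ζ, y ζ)) hmem
    have h1 : ContinuousWithinAt (fun q => rt P q (y q)) (Ici ζ) ζ :=
      ContinuousAt.comp_continuousWithinAt (g := fun z : ℝ × ℝ => rt P z.1 z.2)
        (f := fun q => (q, y q)) (h.contDiffAt_rt hn).continuousAt
        (continuousWithinAt_id.prodMk hyc')
    refine h1.eventually_const_lt ?_
    exact h.lowRt_lt.trans_le (one_le_rt B h hζm hlt.le hζ1.ge)
  obtain ⟨c, hc, hcs⟩ := (mem_nhdsGE_iff_exists_Icc_subset).1 (e1.and (e2.and (e3.and e4)))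
  refine ⟨min c T, ⟨lt_min hc hζT, min_le_right _ _⟩, ?_, fun q hq => ?_⟩
  · change sg P * y u = m P u
    rw [hy.1, h.sm_eq, h.sg_sg]
  have hqT : q ∈ Icc u T := ⟨hq.1, hq.2.trans (min_le_right _ _)⟩
  have hqm : q ∈ Icc u₁ T := ⟨hu.trans hq.1, hqT.2⟩
  obtain ⟨k1, k2⟩ : Regular P q (sg P * y q) ∧
      O P q (sg P * y q) = sg P * fld P δ Λ q (y q) := by
    rcases le_total q ζ with hle | hle
    · have hqζ : q ∈ Icc u ζ := ⟨hq.1, hle⟩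
      have hh := (lt_hi_of_le_sl B (hy.le_sl B h hu huM hζT.le hs hqζ)).le
      exact regular_and_O_eq B h hqm ((B.lower q hqm).le.trans (hs q hqζ)) hh (hs0 q hqζ)
        (h.lowRt_lt.le.trans (one_le_rt B h hqm hh (hs q hqζ)))
    · obtain ⟨g1, g2, g3, g4⟩ := hcs ⟨hle, hq.2.trans (min_le_left _ _)⟩
      exact regular_and_O_eq B h hqm g1.le g2.le (g3 ⟨hle, hqT.2⟩) g4.le
  refine ⟨k1, ?_⟩
  rw [k2]
  exact ((hy.2 q hqT).mono (Icc_subset_Icc_right (min_le_right _ _))).const_mul _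

/-- Up to the crossing the cut-off is not active. -/
theorem uncut (hy : IsFlow P δ Λ u T y) (B : Box P u₁ T δ Λ) (h : Good P)
    (hu : u₁ ≤ u) (huM : u ≤ qM P) {z : ℝ} (hzT : z ≤ T)
    (hs : ∀ q ∈ Icc u z, sm P q ≤ y q) {q : ℝ} (hq : q ∈ Icc u z) :
    0 < nrt P q (y q) ∧ 1 ≤ rt P q (y q) ∧ 0 < dn P q (rt P q (y q)) ∧
      cost P δ Λ q (y q) = P.R / q * ((rt P q (y q) - 1) / dn P q (rt P q (y q))) ∧
      fld P δ Λ q (y q) = -(ra P * max 0 (sg P * y q) *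
        ((rt P q (y q) - 1) / dn P q (rt P q (y q)))) := by
  have hqm : q ∈ Icc u₁ T := ⟨hu.trans hq.1, hq.2.trans hzT⟩
  have hh := (lt_hi_of_le_sl B (hy.le_sl B h hu huM hzT hs hq)).le
  have hcl := B.cl_eq (q := q) ((B.lower q hqm).le.trans (hs q hq)) hh
  have hmem := B.cl_mem hqm (y q)
  rw [hcl] at hmem
  have hn := B.nrt_pos h (z := (q, y q)) hmem
  have hD := B.dn_pos h (z := (q, y q)) h.lowRt_lt.le le_rfl hmem
  have h1 := one_le_rt B h hqm hh (hs q hq)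
  dsimp only at hn hD
  rw [max_eq_left h1] at hD
  refine ⟨hn, h1, hD, ?_, ?_⟩
  · rw [cost, hcl, kern, max_eq_left h1]
  · rw [fld, hcl, kern, max_eq_left (h.lowRt_lt.le.trans h1)]

theorem cost_eq (hy : IsFlow P δ Λ u T y) (B : Box P u₁ T δ Λ) (h : Good P)
    (hu : u₁ ≤ u) (huM : u ≤ qM P) {ζ : ℝ} (hζT : ζ ≤ T)
    (hs : ∀ q ∈ Icc u ζ, sm P q ≤ y q) {f : ℝ → ℝ} {q : ℝ} (hq : q ∈ Icc u ζ)
    (hf : f q = sg P * y q) : cost P δ Λ q (y q) = integrand P f q := by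
  obtain ⟨hn, -, hD, hc, -⟩ := hy.uncut B h hu huM hζT hs hq
  rw [h.integrand_eq hf hn hD.ne', hc]

end IsFlow

/-! ### Identification of `ζ` and `Σ`. -/

theorem IsSolution.mono {u z z' : ℝ} {f : ℝ → ℝ} (hf : IsSolution P u z f) (hz : z' ≤ z) :
    IsSolution P u z' f :=
  ⟨hf.1, fun t ht => have ht' : t ∈ Icc u z := ⟨ht.1, ht.2.trans hz⟩
    ⟨(hf.2 t ht').1, (hf.2 t ht').2.mono (Icc_subset_Icc_right hz)⟩⟩

theorem IsSolution.congr {u z : ℝ} {f g : ℝ → ℝ} (hf : IsSolution P u z f) (huz : u ≤ z)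
    (hfg : EqOn f g (Icc u z)) : IsSolution P u z g := by
  refine ⟨by rw [← hfg ⟨le_rfl, huz⟩, hf.1], fun t ht => ?_⟩
  rw [← hfg ht]
  exact ⟨(hf.2 t ht).1, (hf.2 t ht).2.congr (fun s hs => (hfg hs).symm) (hfg ht).symm⟩

namespace Good

theorem crossing_iff (h : Good P) {q y : ℝ} :
    (1 - P.R) * (sg P * y) < (1 - P.R) * m P q ↔ y < sm P q := by
  rw [h.mul_lt_mul_iff_sg, h.sg_sg, ← h.sm_eq]

theorem zeta_eq (h : Good P) {u ζ z : ℝ} {y : ℝ → ℝ} (huζ : u ≤ ζ) (hζz : ζ < z)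
    (hsol : IsSolution P u z (fun q => sg P * y q)) (hs : ∀ q ∈ Icc u ζ, sm P q ≤ y q)
    (hs' : ∀ q ∈ Ioc ζ z, y q < sm P q) :
    (crossingSet P u).Nonempty ∧ zeta P u = ζ := by
  have he := h.nSol_eq hsol
  have h1 : ∀ q ∈ crossingSet P u, ζ < q := by
    rintro q ⟨⟨huq, -⟩, hq⟩
    by_contra! hle
    rw [← he ⟨huq, hle.trans hζz.le⟩, h.crossing_iff] at hq
    exact hq.not_ge (hs q ⟨huq, hle⟩)
  have h2 : ∀ q ∈ Ioc ζ z, q ∈ crossingSet P u := by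
    intro q hq
    have huq : u ≤ q := huζ.trans hq.1.le
    refine ⟨⟨huq, _, hsol.mono hq.2⟩, ?_⟩
    rw [← he ⟨huq, hq.2⟩, h.crossing_iff]
    exact hs' q hq
  have hne : (crossingSet P u).Nonempty := ⟨z, h2 z ⟨hζz, le_rfl⟩⟩
  refine ⟨hne, csInf_eq_of_forall_ge_of_forall_gt_exists_lt hne (fun q hq => (h1 q hq).le) ?_⟩
  intro w hw
  obtain ⟨v, hv1, hv2⟩ := exists_between (lt_min hw hζz)
  exact ⟨v, h2 v ⟨hv1, hv2.le.trans (min_le_right _ _)⟩, hv2.trans_le (min_le_left _ _)⟩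

end Good

namespace IsFlow

variable {u₁ T δ Λ u u' : ℝ} {y y' : ℝ → ℝ}

theorem continuousOn_cost (hy : IsFlow P δ Λ u T y) (B : Box P u₁ T δ Λ) (h : Good P)
    (hu : u₁ ≤ u) : ContinuousOn (fun q => cost P δ Λ q (y q)) (Icc u T) :=
  B.continuousOn_cost h (Icc_subset_Icc_left hu) hy.continuousOn

theorem intervalIntegrable_cost (hy : IsFlow P δ Λ u T y) (B : Box P u₁ T δ Λ) (h : Good P)
    (hu : u₁ ≤ u) {a b : ℝ} (ha : u ≤ a) (hab : a ≤ b) (hb : b ≤ T) :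
    IntervalIntegrable (fun q => cost P δ Λ q (y q)) MeasureTheory.volume a b :=
  ((hy.continuousOn_cost B h hu).mono
    (by rw [uIcc_of_le hab]; exact Icc_subset_Icc ha hb)).intervalIntegrable

/-- The properties of the round-trip cost read off from the cut-off equation. -/
theorem summary (hy : IsFlow P δ Λ u T y) (B : Box P u₁ T δ Λ) (h : Good P)
    (hu : u₁ ≤ u) (huM : u ≤ qM P) (h0 : 0 ≤ sg P * sm P u) :
    WellDefinedAt P u ∧ zeta P u ∈ Icc (qM P) (2 * qM P - u) ∧
      y (zeta P u) = sm P (zeta P u) ∧ (∀ q ∈ Icc u (zeta P u), sm P q ≤ y q) ∧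
      (∀ q ∈ Icc u (zeta P u), nSol P u q = sg P * y q) ∧
      Sig P u = Real.exp (∫ q in u..T, cost P δ Λ q (y q)) - 1 := by
  obtain ⟨ζ, hζ, hζ1, hs, hs'⟩ := hy.exists_crossing B h hu huM
  obtain ⟨z, hz, hsol⟩ := hy.exists_isSolution B h hu huM h0 hζ hζ1 hs
  have huζ : u ≤ ζ := huM.trans hζ.1
  have hζT : ζ ≤ T := hz.1.le.trans hz.2
  have he := h.nSol_eq hsol
  obtain ⟨hne, hzeta⟩ := h.zeta_eq huζ hz.1 hsol hs fun q hq => hs' q ⟨hq.1, hq.2.trans hz.2⟩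
  have hn : ∀ q ∈ Icc u ζ, nSol P u q = sg P * y q := fun q hq =>
    (he ⟨hq.1, hq.2.trans hz.1.le⟩).symm
  have hci : EqOn (fun q => cost P δ Λ q (y q)) (integrand P (nSol P u)) (uIcc u ζ) := by
    rw [uIcc_of_le huζ]
    exact fun q hq => hy.cost_eq B h hu huM hζT hs hq (hn q hq)
  have hint : IntervalIntegrable (integrand P (nSol P u)) MeasureTheory.volume u ζ :=
    (((hy.continuousOn_cost B h hu).mono (by
      rw [uIcc_of_le huζ]; exact Icc_subset_Icc_right hζT)).congr hci.symm).intervalIntegrable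
  -- Beyond the crossing the solution is below `M`, where the cut-off cost is zero.
  have hzero : ∫ q in ζ..T, cost P δ Λ q (y q) = 0 := by
    rw [intervalIntegral.integral_congr (g := fun _ => (0 : ℝ)), intervalIntegral.integral_zero]
    rw [uIcc_of_le hζT]
    intro q hq
    refine B.cost_eq_zero h ⟨hu.trans (huζ.trans hq.1), hq.2⟩ ?_
    rcases hq.1.eq_or_lt with rfl | hlt
    · exact hζ1.le
    · exact (hs' q ⟨hlt, hq.2⟩).le
  rw [hzeta]
  refine ⟨⟨fun z f hf => h.nSol_eq hf, hne, ⟨z, by rw [hzeta]; exact hz.1, ?_⟩, by rwa [hzeta]⟩,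
    hζ, hζ1, hs, hn, ?_⟩
  · exact hsol.congr (huζ.trans hz.1.le) he
  · rw [Sig, hzeta, ← intervalIntegral.integral_congr hci,
      ← intervalIntegral.integral_add_adjacent_intervals
        (hy.intervalIntegrable_cost B h hu le_rfl huζ hζT)
        (hy.intervalIntegrable_cost B h hu huζ hζT le_rfl), hzero, add_zero]

/-! ### Dependence on the starting point. -/

theorem dist_le (hy : IsFlow P δ Λ u T y) (hy' : IsFlow P δ Λ u' T y') {K : NNReal}
    (hK : ∀ q ∈ Icc u₁ T, LipschitzWith K (fld P δ Λ q)) {a : ℝ} (hu1 : u₁ ≤ a) (ha : u ≤ a)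
    (ha' : u' ≤ a) {ε : ℝ} (hε : |y a - y' a| ≤ ε) {q : ℝ} (hq : q ∈ Icc a T) :
    |y q - y' q| ≤ ε * Real.exp (K * (q - a)) := by
  have := dist_le_of_trajectories_ODE_of_mem (v := fun q w => fld P δ Λ q w) (s := fun _ => univ)
    (K := K) (f := y) (g := y') (a := a) (b := T) (δ := ε)
    (fun t ht => (hK t ⟨hu1.trans ht.1, ht.2.le⟩).lipschitzOnWith)
    (hy.continuousOn.mono (Icc_subset_Icc_left ha))
    (fun t ht => (hy.2 t ⟨ha.trans ht.1, ht.2.le⟩).Ici_of_Icc ⟨ha.trans ht.1, ht.2⟩)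
    (fun _ _ => mem_univ _)
    (hy'.continuousOn.mono (Icc_subset_Icc_left ha'))
    (fun t ht => (hy'.2 t ⟨ha'.trans ht.1, ht.2.le⟩).Ici_of_Icc ⟨ha'.trans ht.1, ht.2⟩)
    (fun _ _ => mem_univ _) hε q hq
  exact this

/-- Solutions started earlier stay above solutions started later. -/
theorem le_of_le (hy : IsFlow P δ Λ u T y) (hy' : IsFlow P δ Λ u' T y') (B : Box P u₁ T δ Λ)
    (h : Good P) (hu : u₁ ≤ u) (huu : u ≤ u') (huM : u' ≤ qM P) {q : ℝ} (hq : q ∈ Icc u' T) :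
    y' q ≤ y q := by
  obtain ⟨K, hK⟩ := B.exists_fld_lipschitz h
  by_contra! hlt
  have hc : ContinuousOn (fun t => y t - y' t) (Icc u' q) :=
    (hy.continuousOn.mono (Icc_subset_Icc huu hq.2)).sub
      (hy'.continuousOn.mono (Icc_subset_Icc_right hq.2))
  have h0 : y' u' ≤ y u' := by
    rw [hy'.1]; exact hy.sm_le B h hu ⟨huu, huM⟩
  -- If the order were reversed the two solutions would meet at some `a`; Gronwall with zero initial
  -- distance would then keep them equal.
  obtain ⟨a, ha, ha0⟩ := intermediate_value_Icc' hq.1 hc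
    (show (0 : ℝ) ∈ Icc _ _ from ⟨sub_nonpos.2 hlt.le, sub_nonneg.2 h0⟩)
  have h1 := hy.dist_le hy' hK (hu.trans (huu.trans ha.1)) (huu.trans ha.1) ha.1
    (ε := 0) (by simp only at ha0; rw [ha0, abs_zero]) ⟨ha.2, hq.2⟩
  rw [zero_mul] at h1
  have := abs_nonpos_iff.1 h1
  linarith

theorem abs_sub_le (hy : IsFlow P δ Λ u T y) {C : ℝ} (hu : u₁ ≤ u)
    (hC : ∀ q ∈ Icc u₁ T, ∀ y, |fld P δ Λ q y| ≤ C) {q : ℝ} (hq : q ∈ Icc u T) :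
    |y q - y u| ≤ C * (q - u) := by
  have := (convex_Icc u T).norm_image_sub_le_of_norm_hasDerivWithin_le (f := y)
    (f' := fun q => fld P δ Λ q (y q)) hy.2 (fun t ht => hC t ⟨hu.trans ht.1, ht.2⟩ _)
    (x := u) (y := q) ⟨le_rfl, hq.1.trans hq.2⟩ hq
  rwa [Real.norm_eq_abs, Real.norm_eq_abs, abs_of_nonneg (sub_nonneg.2 hq.1)] at this

end IsFlow

namespace Box

variable {u₁ T δ Λ : ℝ}

/-- Lipschitz dependence of the solutions on the starting point. -/
theorem exists_flow_lipschitz (B : Box P u₁ T δ Λ) (h : Good P) :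
    ∃ C, 0 ≤ C ∧ ∀ u u' y y', u₁ ≤ u → u ≤ u' → u' ≤ qM P → IsFlow P δ Λ u T y →
      IsFlow P δ Λ u' T y' → ∀ q ∈ Icc u' T, |y q - y' q| ≤ C * (u' - u) := by
  obtain ⟨K, hK⟩ := B.exists_fld_lipschitz h
  obtain ⟨C, hC0, hC⟩ := B.exists_fld_bound h
  obtain ⟨C', hC'⟩ : ∃ C, ∀ q ∈ Icc u₁ (qM P), ‖smDeriv P q‖ ≤ C := by
    refine isCompact_Icc.exists_bound_of_continuousOn ?_
    unfold smDeriv; fun_prop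
  have hMT := IsFlow.qM_lt B h
  refine ⟨(C + max C' 0) * Real.exp (K * (T - u₁)), by positivity, ?_⟩
  intro u u' y y' hu huu huM hy hy' q hq
  have h1 := hy.abs_sub_le hu hC ⟨huu, huM.trans hMT.le⟩
  have h2 : |sm P u' - sm P u| ≤ C' * (u' - u) := by
    have := (convex_Icc u₁ (qM P)).norm_image_sub_le_of_norm_hasDerivWithin_le (f := sm P)
      (f' := smDeriv P) (fun t _ => (hasDerivAt_sm t).hasDerivWithinAt) hC'
      (x := u) (y := u') ⟨hu, huu.trans huM⟩ ⟨hu.trans huu, huM⟩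
    rwa [Real.norm_eq_abs, Real.norm_eq_abs, abs_of_nonneg (sub_nonneg.2 huu)] at this
  have h3 : |y u' - y' u'| ≤ (C + max C' 0) * (u' - u) := by
    rw [hy'.1]
    rw [hy.1] at h1
    calc |y u' - sm P u'| = |(y u' - sm P u) - (sm P u' - sm P u)| := by ring_nf
      _ ≤ |y u' - sm P u| + |sm P u' - sm P u| := abs_sub _ _
      _ ≤ C * (u' - u) + max C' 0 * (u' - u) :=
        add_le_add h1 (h2.trans (mul_le_mul_of_nonneg_right (le_max_left _ _) (by linarith)))
      _ = _ := by ring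
  have h4 := hy.dist_le hy' hK (hu.trans huu) huu le_rfl h3 hq
  refine h4.trans ?_
  have : 0 ≤ u' - u := by linarith
  have e : Real.exp (K * (q - u')) ≤ Real.exp (K * (T - u₁)) := by
    have := K.coe_nonneg
    gcongr
    · exact hq.2
    · exact hu.trans huu
  calc (C + max C' 0) * (u' - u) * Real.exp (K * (q - u'))
      ≤ (C + max C' 0) * (u' - u) * Real.exp (K * (T - u₁)) := by gcongr
    _ = _ := by ring

end Box

namespace IsFlow

variable {u₁ T δ Λ u u' : ℝ} {y y' : ℝ → ℝ}

/-- On `[u', T]` the earlier solution is larger and the cost is monotone. Strictness comes from `(u,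
u')`, where that solution is strictly above `M`. -/
theorem integral_cost_lt (hy : IsFlow P δ Λ u T y) (hy' : IsFlow P δ Λ u' T y')
    (B : Box P u₁ T δ Λ) (h : Good P) (hu : u₁ ≤ u) (huu : u < u') (huM : u' ≤ qM P) :
    ∫ q in u'..T, cost P δ Λ q (y' q) < ∫ q in u..T, cost P δ Λ q (y q) := by
  have hT : u' ≤ T := huM.trans (qM_lt B h).le
  rw [← intervalIntegral.integral_add_adjacent_intervals
        (hy.intervalIntegrable_cost B h hu le_rfl huu.le hT)
        (hy.intervalIntegrable_cost B h hu huu.le hT le_rfl)]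
  have h1 : ∫ q in u'..T, cost P δ Λ q (y' q) ≤ ∫ q in u'..T, cost P δ Λ q (y q) := by
    refine intervalIntegral.integral_mono_on hT
      (hy'.intervalIntegrable_cost B h (hu.trans huu.le) le_rfl hT le_rfl)
      (hy.intervalIntegrable_cost B h hu huu.le hT le_rfl) fun q hq => ?_
    exact B.cost_mono h ⟨hu.trans (huu.le.trans hq.1), hq.2⟩
      (hy.le_of_le hy' B h hu huu.le huM hq)
  have h2 : 0 < ∫ q in u..u', cost P δ Λ q (y q) := by
    refine intervalIntegral.intervalIntegral_pos_of_pos_on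
      (hy.intervalIntegrable_cost B h hu le_rfl huu.le hT) (fun q hq => ?_) huu
    have hqM : q ∈ Ioo u (qM P) := ⟨hq.1, hq.2.trans_le huM⟩
    have hqT : q ∈ Icc u₁ T := ⟨hu.trans hq.1.le, hq.2.le.trans hT⟩
    refine B.cost_pos h hqT ?_
    refine lt_max_of_lt_right (lt_min (hy.sm_lt B h hu hqM) ?_)
    refine lt_max_of_lt_left ?_
    rcases le_total q 1 with hq1 | hq1
    · rw [min_eq_left hq1]
      linarith [B.gap q ⟨hqT.1, hq1⟩, B.δ_pos]
    · rw [min_eq_right hq1]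
      linarith [B.gap 1 ⟨B.lt_one.le, le_rfl⟩, B.δ_pos, h.sm_anti hq1 hqM.2.le]
  linarith

end IsFlow

namespace Box

variable {u₁ T δ Λ : ℝ}

theorem exists_integral_cost_lipschitz (B : Box P u₁ T δ Λ) (h : Good P) :
    ∃ C, 0 ≤ C ∧ ∀ u u' y y', u₁ ≤ u → u ≤ u' → u' ≤ qM P → IsFlow P δ Λ u T y →
      IsFlow P δ Λ u' T y' → |(∫ q in u..T, cost P δ Λ q (y q)) -
        ∫ q in u'..T, cost P δ Λ q (y' q)| ≤ C * (u' - u) := by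
  obtain ⟨L, hL0, hL⟩ := B.exists_flow_lipschitz h
  obtain ⟨C, hC0, hC⟩ := B.exists_cost_bound h
  obtain ⟨C', hC0', hC'⟩ := B.exists_cost_lipschitz h
  have hT0 : 0 ≤ T - u₁ := by linarith [B.one_le_T h, B.lt_one]
  refine ⟨C + C' * L * (T - u₁), by positivity, ?_⟩
  intro u u' y y' hu huu huM hy hy'
  have hT : u' ≤ T := huM.trans (IsFlow.qM_lt B h).le
  have i1 := hy.intervalIntegrable_cost B h hu le_rfl huu hT
  have i2 := hy.intervalIntegrable_cost B h hu huu hT le_rfl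
  have i3 := hy'.intervalIntegrable_cost B h (hu.trans huu) le_rfl hT le_rfl
  rw [← intervalIntegral.integral_add_adjacent_intervals i1 i2, add_sub_assoc,
    ← intervalIntegral.integral_sub i2 i3]
  have e1 : ‖∫ q in u..u', cost P δ Λ q (y q)‖ ≤ C * |u' - u| := by
    refine intervalIntegral.norm_integral_le_of_norm_le_const fun q hq => ?_
    rw [uIoc_of_le huu] at hq
    exact hC q ⟨hu.trans hq.1.le, hq.2.trans hT⟩ _
  have hd : 0 ≤ u' - u := by linarith
  have e2 : ‖∫ q in u'..T, (cost P δ Λ q (y q) - cost P δ Λ q (y' q))‖ ≤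
      C' * (L * (u' - u)) * |T - u'| := by
    refine intervalIntegral.norm_integral_le_of_norm_le_const fun q hq => ?_
    rw [uIoc_of_le hT] at hq
    refine (hC' q ⟨(hu.trans huu).trans hq.1.le, hq.2⟩ _ _).trans ?_
    exact mul_le_mul_of_nonneg_left (hL u u' y y' hu huu huM hy hy' q ⟨hq.1.le, hq.2⟩) hC0'
  rw [abs_of_nonneg hd] at e1
  rw [abs_of_nonneg (sub_nonneg.2 hT)] at e2
  calc _ ≤ _ := abs_add_le _ _
    _ ≤ C * (u' - u) + C' * (L * (u' - u)) * (T - u') := add_le_add e1 e2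
    _ ≤ C * (u' - u) + C' * (L * (u' - u)) * (T - u₁) := by
      have := hu.trans huu
      gcongr
    _ = _ := by ring

end Box

/-! ### Divergence of the cost as `u` tends to `0`. -/

namespace Good

/-- The cost is at least proportional to `(y - M) / q²`. -/
theorem sub_le_cost (h : Good P) {q y : ℝ} (hq : 0 < q) (hq1 : q ≤ 1) (hn : 0 < nrt P q y)
    (hp : 1 ≤ rt P q y) (hD : 0 < dn P q (rt P q y)) :
    (y - sm P q) / q ^ 2 ≤ P.b₂ / (cc P * P.R) *
      (P.R / q * ((rt P q y - 1) / dn P q (rt P q y))) := by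
  have hR := h.R_pos
  have hc := h.cc_pos
  have hb := h.be_pos
  have he := h.rt_eq hn
  have hp0 := h.rt_pos hn
  have h1 : cc P * (y - sm P q) ≤ P.b₂ * (rt P q y - 1) := by
    have h2 : (rt P q y - 1) * ((1 - q) ^ 2 * rt P q y + (P.b₂ - 1)) ≤
        (rt P q y - 1) * (P.b₂ * rt P q y) := by
      refine mul_le_mul_of_nonneg_left ?_ (by linarith)
      have : (1 - q) ^ 2 ≤ 1 := by nlinarith
      nlinarith
    rw [he] at h2
    refine le_of_mul_le_mul_right ?_ hp0
    linarith
  have hDq : dn P q (rt P q y) ≤ q := by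
    unfold dn
    nlinarith [mul_nonneg (mul_nonneg hR.le (sub_nonneg.2 hq1)) (sub_nonneg.2 hp)]
  have h3 : (rt P q y - 1) / q ≤ (rt P q y - 1) / dn P q (rt P q y) := by
    have : 0 ≤ rt P q y - 1 := by linarith
    gcongr
  calc (y - sm P q) / q ^ 2 = cc P * (y - sm P q) / (cc P * q ^ 2) := by field_simp
    _ ≤ P.b₂ * (rt P q y - 1) / (cc P * q ^ 2) := by gcongr
    _ = P.b₂ / (cc P * P.R) * (P.R / q * ((rt P q y - 1) / q)) := by field_simp
    _ ≤ _ := by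
      have : 0 < P.b₂ := by linarith
      gcongr

/-- The cost of the solutions started at `u` grows at least like a multiple of `log (1 / u)`. -/
theorem exists_log_le (h : Good P) : ∃ r C A D : ℝ, 0 < r ∧ 0 < C ∧ 0 < A ∧
    ∀ u₁ T δ Λ u y, Box P u₁ T δ Λ → u₁ ≤ u → u < r → IsFlow P δ Λ u T y →
      A * (Real.log r - Real.log u) - D ≤ C * ∫ q in u..T, cost P δ Λ q (y q) := by
  have hR := h.R_pos
  have hra := h.ra_pos
  have hb₁ := h.b₁_pos
  have hcc := h.cc_pos
  have hM := h.qM_pos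
  have hb₂ : 0 < P.b₂ := by linarith [h.be_pos]
  -- Below `q_M/2` the slope of `M` is at most `-R(ra/b₁) q_M`, and this number is the constant `A`.
  set r := min (1 / 2) (qM P / 2) with hr
  have hr0 : 0 < r := lt_min (by norm_num) (by linarith)
  have hr1 : r ≤ 1 / 2 := min_le_left _ _
  have hr2 : r ≤ qM P / 2 := min_le_right _ _
  set N := 1 + |sm P (qM P)| with hN
  have hN0 : 0 < N := by positivity
  refine ⟨r, ra P * N / P.R + P.b₂ / (cc P * P.R), P.R * (ra P / P.b₁) * qM P,
    (sg P - sm P (qM P)) / r, hr0, by positivity, by positivity, ?_⟩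
  intro u₁ T δ Λ u y B hu hur hy
  have hu0 := B.pos.trans_le hu
  have hMT := IsFlow.qM_lt B h
  have hrM : r ≤ qM P := by linarith
  have huM : u ≤ qM P := hur.le.trans hrM
  have hrT : r ≤ T := hrM.trans hMT.le
  have hs : ∀ q ∈ Icc u r, sm P q ≤ y q := fun q hq => hy.sm_le B h hu ⟨hq.1, hq.2.trans hrM⟩
  have hanti := hy.antitoneOn B h hu hrT hs
  have hub : ∀ q ∈ Icc u r, y q ≤ sg P := by
    intro q hq
    have h1 := hanti ⟨le_rfl, hur.le⟩ hq hq.1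
    rw [hy.1] at h1
    have h2 := h.sm_anti hu0.le huM
    rw [IsFlow.sm_zero] at h2
    linarith
  have hlb : ∀ q ∈ Icc u r, sm P (qM P) ≤ sm P q := fun q hq =>
    h.sm_anti (hq.2.trans hrM) le_rfl
  have hsg : sg P ≤ 1 := (le_abs_self _).trans (Box.abs_sg h).le
  have hi1 := hy.intervalIntegrable_cost B h hu le_rfl hur.le hrT
  have hi2 := hy.intervalIntegrable_cost B h hu hur.le hrT le_rfl
  have hC0 : 0 ≤ ra P * N / P.R + P.b₂ / (cc P * P.R) := by positivity
  have hle : ∫ q in u..r, cost P δ Λ q (y q) ≤ ∫ q in u..T, cost P δ Λ q (y q) := by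
    rw [← intervalIntegral.integral_add_adjacent_intervals hi1 hi2]
    have : 0 ≤ ∫ q in r..T, cost P δ Λ q (y q) :=
      intervalIntegral.integral_nonneg hrT fun q hq =>
        B.cost_nonneg h ⟨hu.trans (hur.le.trans hq.1), hq.2⟩ _
    linarith
  refine le_trans ?_ (mul_le_mul_of_nonneg_left hle hC0)
  rw [← intervalIntegral.integral_const_mul]
  have hsub : Icc u r ⊆ Icc u T := Icc_subset_Icc_right hrT
  have hcont : ContinuousOn (fun q => P.R * (ra P / P.b₁) * qM P * Real.log q -
      (y q - sm P q) / q) (Icc u r) := by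
    have h0 : ∀ q ∈ Icc u r, q ≠ 0 := fun q hq => (hu0.trans_le hq.1).ne'
    exact (continuousOn_const.mul (continuousOn_id.log h0)).sub
      (((hy.continuousOn.mono hsub).sub continuous_sm.continuousOn).div continuousOn_id h0)
  -- The function `A log q - (y-M)/q` has derivative at most `C` times the cost. The slope of `M`
  -- absorbs `A/q`, the field contributes at most `ra N/R` times the cost, and `(y-M)/q²` is
  -- controlled by `sub_le_cost`. At `u` the second term vanishes; at `r` it is at most `D`.
  have key := intervalIntegral.sub_le_integral_of_hasDeriv_right_of_le hur.le hcont
    (g' := fun q => P.R * (ra P / P.b₁) * qM P * q⁻¹ -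
      ((fld P δ Λ q (y q) - smDeriv P q) * q - (y q - sm P q) * 1) / q ^ 2)
    (φ := fun q => (ra P * N / P.R + P.b₂ / (cc P * P.R)) * cost P δ Λ q (y q))
    (fun q hq => ?_) ?_ fun q hq => ?_
  · have hw : (y r - sm P r) / r ≤ (sg P - sm P (qM P)) / r := by
      have := hub r ⟨hur.le, le_rfl⟩
      have := hlb r ⟨hur.le, le_rfl⟩
      gcongr
    simp only [hy.1, sub_self, zero_div, sub_zero] at key
    linarith
  · have hq0 : q ≠ 0 := (hu0.trans hq.1).ne'
    have h1 := (hy.hasDerivWithinAt_sub le_rfl hrT ⟨hq.1.le, hq.2.le⟩).div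
      (hasDerivWithinAt_id q (Icc u r)) hq0
    have h2 := ((Real.hasDerivAt_log hq0).const_mul
      (P.R * (ra P / P.b₁) * qM P)).hasDerivWithinAt (s := Icc u r)
    exact (h2.sub h1).mono_of_mem_nhdsWithin
      (mem_of_superset (Ioo_mem_nhdsGT hq.2) fun t ht => ⟨hq.1.le.trans ht.1.le, ht.2.le⟩)
  · exact ((hy.continuousOn_cost B h hu).mono hsub |>.const_smul
      (ra P * N / P.R + P.b₂ / (cc P * P.R))).integrableOn_Icc
  · have hqr : q ∈ Icc u r := ⟨hq.1.le, hq.2.le⟩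
    have hq0 : 0 < q := hu0.trans hq.1
    have hq1 : q ≤ 1 := by linarith [hq.2]
    obtain ⟨hn, hp, hD, hcost, hfld⟩ := hy.uncut B h hu huM hrT hs hqr
    have h1 := h.sub_le_cost hq0 hq1 hn hp hD
    rw [← hcost] at h1
    have hX : (rt P q (y q) - 1) / dn P q (rt P q (y q)) = q / P.R * cost P δ Λ q (y q) := by
      rw [hcost]; field_simp
    have hNy : max 0 (sg P * y q) ≤ N := by
      refine max_le hN0.le ((le_abs_self _).trans ?_)
      rw [abs_mul, Box.abs_sg h, one_mul, abs_le]
      have := hub q hqr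
      have := hlb q hqr
      have := hs q hqr
      have := neg_abs_le (sm P (qM P))
      have := abs_nonneg (sm P (qM P))
      constructor <;> linarith
    have hc0 := B.cost_nonneg h (q := q) ⟨hu.trans hq.1.le, hq.2.le.trans hrT⟩ (y q)
    have h2 : -(ra P * N / P.R * cost P δ Λ q (y q)) ≤ fld P δ Λ q (y q) / q := by
      rw [hfld, hX]
      calc -(ra P * N / P.R * cost P δ Λ q (y q))
          ≤ -(ra P * max 0 (sg P * y q) / P.R * cost P δ Λ q (y q)) := by gcongr
        _ = _ := by field_simp
    have h3 : P.R * (ra P / P.b₁) * qM P * q⁻¹ ≤ -smDeriv P q / q := by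
      rw [h.smDeriv_eq, ← div_eq_mul_inv]
      refine div_le_div_of_nonneg_right ?_ hq0.le
      have : P.R * (ra P / P.b₁) * (2 * q) ≤ P.R * (ra P / P.b₁) * qM P := by
        have := hq.2
        gcongr
        linarith
      linarith
    have e : ((fld P δ Λ q (y q) - smDeriv P q) * q - (y q - sm P q) * 1) / q ^ 2 =
        fld P δ Λ q (y q) / q + -smDeriv P q / q - (y q - sm P q) / q ^ 2 := by
      field_simp
      ring
    rw [e, add_mul]
    linarith

/-! ### Monotonicity, continuity and range of `Σ`. -/

theorem sig_mem (h : Good P) {v : ℝ} (hv : v ≤ qM P)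
    (hm : ∀ u ∈ Ioc 0 v, 0 ≤ sg P * sm P u) {u₁ u T δ Λ : ℝ} (B : Box P u₁ T δ Λ)
    (hu : u₁ ≤ u) (huv : u ≤ v) : ∃ y, IsFlow P δ Λ u T y ∧ WellDefinedAt P u ∧
      Sig P u = Real.exp (∫ q in u..T, cost P δ Λ q (y q)) - 1 := by
  have huM := huv.trans hv
  obtain ⟨y, hy⟩ := B.exists_flow h ⟨hu, huM.trans (IsFlow.qM_lt B h).le⟩
  have := hy.summary B h hu huM (hm u ⟨B.pos.trans_le hu, huv⟩)
  exact ⟨y, hy, this.1, this.2.2.2.2.2⟩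

theorem exists_box_le (h : Good P) {u : ℝ} (hu : 0 < u) :
    ∃ u₁ T δ Λ, u₁ < u ∧ Box P u₁ T δ Λ := by
  obtain ⟨δ, Λ, B⟩ := h.exists_box (u₁ := min u 1 / 2) (T := 2 * qM P + 1) (by positivity)
    (by linarith [min_le_right u 1]) le_rfl
  have : 0 < min u 1 := by positivity
  exact ⟨_, _, δ, Λ, by linarith [min_le_left u 1], B⟩

theorem wellDefinedAt (h : Good P) {v : ℝ} (hv : v ≤ qM P)
    (hm : ∀ u ∈ Ioc 0 v, 0 ≤ sg P * sm P u) {u : ℝ} (hu : u ∈ Ioc 0 v) : WellDefinedAt P u := by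
  obtain ⟨u₁, T, δ, Λ, hlt, B⟩ := h.exists_box_le hu.1
  obtain ⟨y, -, hw, -⟩ := h.sig_mem hv hm B hlt.le hu.2
  exact hw

theorem strictAntiOn_sig (h : Good P) {v : ℝ} (hv : v ≤ qM P)
    (hm : ∀ u ∈ Ioc 0 v, 0 ≤ sg P * sm P u) : StrictAntiOn (Sig P) (Ioc 0 v) := by
  intro u hu u' hu' huu
  obtain ⟨u₁, T, δ, Λ, hlt, B⟩ := h.exists_box_le hu.1
  obtain ⟨y, hy, -, he⟩ := h.sig_mem hv hm B hlt.le hu.2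
  obtain ⟨y', hy', -, he'⟩ := h.sig_mem hv hm B (hlt.trans huu).le hu'.2
  have := hy.integral_cost_lt hy' B h hlt.le huu (hu'.2.trans hv)
  rw [he, he']
  gcongr

theorem continuousOn_sig (h : Good P) {v : ℝ} (hv : v ≤ qM P)
    (hm : ∀ u ∈ Ioc 0 v, 0 ≤ sg P * sm P u) : ContinuousOn (Sig P) (Ioc 0 v) := by
  intro u hu
  obtain ⟨u₁, T, δ, Λ, hlt, B⟩ := h.exists_box_le hu.1
  obtain ⟨C, hC0, hC⟩ := B.exists_integral_cost_lipschitz h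
  have hdom : ∀ w, ∃ y, w ∈ Icc u₁ v → IsFlow P δ Λ w T y ∧
      Sig P w = Real.exp (∫ q in w..T, cost P δ Λ q (y q)) - 1 := by
    intro w
    by_cases hw : w ∈ Icc u₁ v
    · obtain ⟨y, hy, -, he⟩ := h.sig_mem hv hm B hw.1 hw.2
      exact ⟨y, fun _ => ⟨hy, he⟩⟩
    · exact ⟨fun _ => 0, fun h' => absurd h' hw⟩
  choose Y hY using hdom
  -- One box with `u₁ < u` serves all starting points near `u`, so the Lipschitz constant is
  -- uniform.
  have hlip : LipschitzOnWith ⟨C, hC0⟩ (fun w => ∫ q in w..T, cost P δ Λ q (Y w q))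
      (Icc u₁ v) := by
    refine LipschitzOnWith.of_dist_le_mul fun w hw w' hw' => ?_
    rw [Real.dist_eq, Real.dist_eq]
    change _ ≤ C * |w - w'|
    rcases le_total w w' with hle | hle
    · rw [abs_sub_comm w, abs_of_nonneg (sub_nonneg.2 hle)]
      exact hC w w' _ _ hw.1 hle (hw'.2.trans hv) (hY w hw).1 (hY w' hw').1
    · rw [abs_sub_comm, abs_of_nonneg (sub_nonneg.2 hle)]
      exact hC w' w _ _ hw'.1 hle (hw.2.trans hv) (hY w' hw').1 (hY w hw).1
  have hc : ContinuousOn (Sig P) (Icc u₁ v) :=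
    (((Real.continuous_exp.comp_continuousOn hlip.continuousOn).sub
      continuousOn_const).congr fun w hw => (hY w hw).2)
  refine (hc u ⟨hlt.le, hu.2⟩).mono_of_mem_nhdsWithin ?_
  filter_upwards [self_mem_nhdsWithin, nhdsWithin_le_nhds (lt_mem_nhds hlt)] with w hw hw1
  exact ⟨hw1.le, hw.2⟩

theorem tendsto_sig (h : Good P) {v : ℝ} (hv0 : 0 < v) (hv : v ≤ qM P)
    (hm : ∀ u ∈ Ioc 0 v, 0 ≤ sg P * sm P u) : Tendsto (Sig P) (𝓝[>] 0) atTop := by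
  obtain ⟨r, C, A, D, hr, hC, hA, hlog⟩ := h.exists_log_le
  have h1 : Tendsto (fun u => Real.exp ((A * (Real.log r - Real.log u) - D) / C) - 1)
      (𝓝[>] 0) atTop := by
    refine tendsto_atTop_add_const_right _ _ (Real.tendsto_exp_atTop.comp ?_)
    refine Tendsto.atTop_div_const hC (tendsto_atTop_add_const_right _ _ ?_)
    refine Tendsto.const_mul_atTop hA (tendsto_atTop_add_const_left _ _ ?_)
    exact tendsto_neg_atBot_atTop.comp Real.tendsto_log_nhdsGT_zero
  refine tendsto_atTop_mono' _ ?_ h1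
  filter_upwards [Ioo_mem_nhdsGT (lt_min hv0 hr)] with u hu
  obtain ⟨u₁, T, δ, Λ, hlt, B⟩ := h.exists_box_le hu.1
  obtain ⟨y, hy, -, he⟩ := h.sig_mem hv hm B hlt.le (hu.2.le.trans (min_le_left _ _))
  have := hlog u₁ T δ Λ u y B hlt.le (hu.2.trans_le (min_le_right _ _)) hy
  rw [he]
  gcongr
  rw [div_le_iff₀ hC]
  linarith

theorem bijOn_sig (h : Good P) {v : ℝ} (hv0 : 0 < v) (hv : v ≤ qM P)
    (hm : ∀ u ∈ Ioc 0 v, 0 ≤ sg P * sm P u) :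
    BijOn (Sig P) (Ioc 0 v) (Ici (Sig P v)) := by
  have hanti := h.strictAntiOn_sig hv hm
  refine ⟨fun u hu => hanti.antitoneOn hu ⟨hv0, le_rfl⟩ hu.2, hanti.injOn, fun s hs => ?_⟩
  obtain ⟨u, hu1, hu2⟩ := (((h.tendsto_sig hv0 hv hm).eventually_ge_atTop s).and
    (Ioo_mem_nhdsGT hv0)).exists
  have hc : ContinuousOn (Sig P) (Icc u v) :=
    (h.continuousOn_sig hv hm).mono fun w hw => ⟨hu2.1.trans_le hw.1, hw.2⟩
  obtain ⟨w, hw, hws⟩ := intermediate_value_Icc' hu2.2.le hc ⟨hs, hu1⟩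
  exact ⟨w, ⟨hu2.1.trans_le hw.1, hw.2⟩, hws⟩

end Good

/-! ### Solutions started at or near a zero of `m`, for `R < 1`. -/

namespace Good

theorem zeta_mem (h : Good P) {u : ℝ} (hu0 : 0 < u) (huM : u ≤ qM P)
    (hm : 0 ≤ sg P * sm P u) : zeta P u ∈ Icc (qM P) (2 * qM P - u) := by
  obtain ⟨u₁, T, δ, Λ, hlt, B⟩ := h.exists_box_le hu0
  obtain ⟨y, hy⟩ := B.exists_flow h ⟨hlt.le, huM.trans (IsFlow.qM_lt B h).le⟩
  exact (hy.summary B h hlt.le huM hm).2.1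

theorem sg_eq_one (h : Good P) (hR : P.R < 1) : sg P = 1 := by
  rcases h.sg_cases with ⟨-, h1, -⟩ | ⟨h1, -⟩
  · exact h1
  · linarith

theorem sm_zeta_nonneg (h : Good P) (hR : P.R < 1) {u : ℝ} (hu0 : 0 < u) (huM : u ≤ qM P)
    (hm : 0 ≤ sm P u) : 0 ≤ sm P (zeta P u) := by
  obtain ⟨u₁, T, δ, Λ, hlt, B⟩ := h.exists_box_le hu0
  obtain ⟨y, hy⟩ := B.exists_flow h ⟨hlt.le, huM.trans (IsFlow.qM_lt B h).le⟩
  obtain ⟨-, hz, hyz, -⟩ := hy.summary B h hlt.le huM (by rwa [h.sg_eq_one hR, one_mul])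
  rw [← hyz]
  exact hy.nonneg B h hR hm ⟨huM.trans hz.1, by linarith [hz.2, B.le_T]⟩

/-- The solution starts at `0`, is nonincreasing while above `M`, and cannot become negative. -/
theorem nSol_eq_zero (h : Good P) (hR : P.R < 1) {u : ℝ} (hu0 : 0 < u) (huM : u ≤ qM P)
    (hm : sm P u = 0) {q : ℝ} (hq : q ∈ Icc u (zeta P u)) : nSol P u q = 0 := by
  obtain ⟨u₁, T, δ, Λ, hlt, B⟩ := h.exists_box_le hu0
  obtain ⟨y, hy⟩ := B.exists_flow h ⟨hlt.le, huM.trans (IsFlow.qM_lt B h).le⟩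
  obtain ⟨-, hz, -, hs, hn, -⟩ := hy.summary B h hlt.le huM (by rw [hm, mul_zero])
  have hzT : zeta P u ≤ T := by linarith [hz.2, B.le_T]
  have h1 := hy.nonneg B h hR hm.ge ⟨hq.1, hq.2.trans hzT⟩
  have h2 := hy.antitoneOn B h hlt.le hzT hs ⟨le_rfl, hq.1.trans hq.2⟩ hq hq.1
  rw [hy.1, hm] at h2
  rw [hn q hq, le_antisymm h2 h1, mul_zero]

theorem lowRt_neg (h : Good P) (hR : P.R < 1) : lowRt P < 0 := by
  unfold lowRt
  have : 1 < 1 / P.R := by rw [lt_div_iff₀ h.R_pos]; linarith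
  linarith

/-- Solutions with a small initial value remain small on bounded intervals. -/
theorem eventually_small (h : Good P) (hR : P.R < 1) {v : ℝ} (hv0 : 0 < v) (hv : v ≤ qM P)
    (hm : sm P v = 0) (K : ℝ) {ε : ℝ} (hε : 0 < ε) :
    ∀ᶠ u in 𝓝[<] v, ∀ q ∈ Icc u K, q ∈ existenceSet P u ∧ |nSol P u q| < ε := by
  obtain ⟨δ, Λ, B⟩ := h.exists_box (u₁ := min v 1 / 2) (T := max K (2 * qM P + 1)) (by positivity)
    (by linarith [min_le_right v 1]) (le_max_right _ _)
  set T := max K (2 * qM P + 1) with hT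
  set u₁ := min v 1 / 2 with hu₁
  have hu₁v : u₁ < v := by
    have : 0 < min v 1 := by positivity
    linarith [min_le_left v 1]
  obtain ⟨L, hL⟩ := B.exists_fld_lipschitz h
  set η := min ε δ with hη
  have hη0 : 0 < η := lt_min hε B.δ_pos
  have hlim : Tendsto (fun u => sm P u * Real.exp (L * (T - u₁))) (𝓝[<] v) (𝓝 0) := by
    have : Tendsto (fun u => sm P u * Real.exp (L * (T - u₁))) (𝓝 v)
        (𝓝 (sm P v * Real.exp (L * (T - u₁)))) := (continuous_sm.tendsto v).mul_const _
    rw [hm, zero_mul] at this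
    exact this.mono_left nhdsWithin_le_nhds
  filter_upwards [hlim.eventually_lt_const hη0, Ioo_mem_nhdsLT hu₁v] with u hsmall hu
  have huM : u ≤ qM P := hu.2.le.trans hv
  have huT : u ≤ T := huM.trans (IsFlow.qM_lt B h).le
  have hmu : 0 ≤ sm P u := by rw [← hm]; exact h.sm_anti hu.2.le hv
  obtain ⟨y, hy⟩ := B.exists_flow h ⟨hu.1.le, huT⟩
  have hy0 : ∀ q ∈ Icc u T, 0 ≤ y q := fun q hq => hy.nonneg B h hR hmu hq
  have hyη : ∀ q ∈ Icc u T, y q < η := by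
    intro q hq
    -- For `R < 1` the zero function solves the cut-off equation, so Gronwall bounds `y` by a
    -- multiple of its initial value `M(u)`.
    have h1 := dist_le_of_trajectories_ODE_of_mem (v := fun q w => fld P δ Λ q w)
      (s := fun _ => univ) (K := L) (f := y) (g := fun _ => 0) (a := u) (b := T) (δ := sm P u)
      (fun t ht => (hL t ⟨hu.1.le.trans ht.1, ht.2.le⟩).lipschitzOnWith)
      hy.continuousOn
      (fun t ht => (hy.2 t ⟨ht.1, ht.2.le⟩).Ici_of_Icc ht)
      (fun _ _ => mem_univ _) continuousOn_const
      (fun t _ => by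
        rw [IsFlow.fld_eq_zero B h hR le_rfl]
        exact hasDerivWithinAt_const _ _ _)
      (fun _ _ => mem_univ _) (by rw [Real.dist_eq, hy.1, sub_zero, abs_of_nonneg hmu]) q hq
    rw [Real.dist_eq, sub_zero, abs_of_nonneg (hy0 q hq)] at h1
    refine (h1.trans ?_).trans_lt hsmall
    have := L.coe_nonneg
    gcongr
    · exact hq.2
    · exact hu.1.le
  have hsg := h.sg_eq_one hR
  have hsol : IsSolution P u T (fun q => sg P * y q) := by
    refine ⟨?_, fun q hq => ?_⟩
    · change sg P * y u = m P u
      rw [hy.1, h.sm_eq, h.sg_sg]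
    have hqm : q ∈ Icc u₁ T := ⟨hu.1.le.trans hq.1, hq.2⟩
    -- Smallness replaces the barrier argument: `y < δ < L - δ` on the left of `1`. This also works
    -- past the crossing, up to any prescribed `K`.
    have hhi : y q ≤ hi P δ q := by
      refine le_max_of_le_left ?_
      have h1 := B.top hR (min q 1) ⟨le_min hqm.1 B.lt_one.le, min_le_right _ _⟩
      have h2 := (hyη q hq).trans_le (min_le_right _ _)
      linarith
    have hlo : -Λ ≤ y q := by linarith [B.Λ_pos, hy0 q hq]
    have hmem := B.cl_mem hqm (y q)
    rw [B.cl_eq hlo hhi] at hmem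
    have hrt := h.rt_pos (B.nrt_pos h (z := (q, y q)) hmem)
    obtain ⟨k1, k2⟩ := IsFlow.regular_and_O_eq B h hqm hlo hhi
      (by rw [hsg, one_mul]; exact hy0 q hq) ((h.lowRt_neg hR).le.trans hrt.le)
    refine ⟨k1, ?_⟩
    rw [k2]
    exact (hy.2 q hq).const_mul _
  intro q hq
  have hqT : q ∈ Icc u T := ⟨hq.1, hq.2.trans (le_max_left _ _)⟩
  refine ⟨⟨hq.1, _, hsol.mono hqT.2⟩, ?_⟩
  rw [← h.nSol_eq hsol hqT]
  dsimp only
  rw [hsg, one_mul, abs_of_nonneg (hy0 q hqT)]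
  exact (hyη q hqT).trans_le (min_le_left _ _)

end Good

/-! ### Conclusion in the two cases. -/

theorem m_eq (hR : 0 < P.R) (hb₁ : 0 < P.b₁) (q : ℝ) :
    m P q = P.R * (1 - P.R) / P.b₁ * (q - qM P) ^ 2 + mM P := by
  have := hR.ne'
  have := hb₁.ne'
  unfold mM m qM
  field_simp
  ring

/-- For `R < 1`, `m(1) ≥ m_M > 0`, the middle term of `ℓ` vanishes at `q = 1`, and the last one is
positive. -/
theorem ell_one_pos (hR : 0 < P.R) (hb₁ : 0 < P.b₁) (hb₂ : 1 < P.b₂) (hM : 0 < mM P)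
    (hR1 : P.R < 1) : 0 < ell P 1 := by
  have h1 := m_eq hR hb₁ (1 : ℝ)
  unfold ell
  rw [h1]
  have : (1 - P.R) * 1 + P.R = 1 := by ring
  rw [this]
  have := sub_pos.2 hR1
  have := sub_pos.2 hb₂
  have h2 : 0 ≤ P.R * (1 - P.R) / P.b₁ * (1 - qM P) ^ 2 := by positivity
  have h3 : 0 < (P.b₂ - 1) * P.R * (1 - P.R) / P.b₁ * (1 / 1) := by positivity
  have h4 : (1 - P.R) / P.b₁ * 1 * (1 - 1) = 0 := by ring
  linarith

end RoundTrip
end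

theorem lemma5p2 (P : RoundTrip.Params)
    (hR : 0 < P.R) (hR1 : P.R ≠ 1) (hb₁ : 0 < P.b₁) (hb₂ : 1 < P.b₂) (hb₃ : 0 < P.b₃) :
    (0 < RoundTrip.mM P →
      (∀ u ∈ Ioc 0 (RoundTrip.qM P), RoundTrip.WellDefinedAt P u) ∧
      StrictAntiOn (RoundTrip.Sig P) (Ioc 0 (RoundTrip.qM P)) ∧
      ContinuousOn (RoundTrip.Sig P) (Ioc 0 (RoundTrip.qM P)) ∧
      BijOn (RoundTrip.Sig P) (Ioc 0 (RoundTrip.qM P)) (Ici 0) ∧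
      Tendsto (RoundTrip.Sig P) (𝓝[>] 0) atTop ∧
      RoundTrip.Sig P (RoundTrip.qM P) = 0) ∧
    (RoundTrip.mM P ≤ 0 → 0 < RoundTrip.ell P 1 →
      ∃ pm pp : ℝ, 0 < pm ∧ pm ≤ pp ∧ {q | RoundTrip.m P q = 0} = {pm, pp} ∧
        (∀ u ∈ Ioc 0 pm, RoundTrip.WellDefinedAt P u) ∧
        IntervalIntegrable (RoundTrip.integrand P (fun _ => 0)) MeasureTheory.volume pm pp ∧
        Tendsto (RoundTrip.Sig P) (𝓝[<] pm) (𝓝 (RoundTrip.xiBar P pm pp)) ∧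
        StrictAntiOn (RoundTrip.Sig P) (Ioc 0 pm) ∧
        ContinuousOn (RoundTrip.Sig P) (Ioc 0 pm) ∧
        BijOn (RoundTrip.Sig P) (Ioc 0 pm) (Ici (RoundTrip.xiBar P pm pp)) ∧
        Tendsto (RoundTrip.Sig P) (𝓝[>] 0) atTop ∧
        RoundTrip.Sig P pm = RoundTrip.xiBar P pm pp ∧
        (∀ K ε : ℝ, 0 < ε → ∀ᶠ u in 𝓝[<] pm, ∀ q ∈ Icc u K,
          q ∈ RoundTrip.existenceSet P u ∧ |RoundTrip.nSol P u q| < ε) ∧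
        Tendsto (RoundTrip.zeta P) (𝓝[<] pm) (𝓝 pp)) := by
  open RoundTrip in
  constructor
  · intro hM
    have h : Good P := ⟨hR, hR1, hb₁, hb₂, hb₃, ell_one_pos hR hb₁ hb₂ hM⟩
    have hm : ∀ u ∈ Ioc 0 (qM P), 0 ≤ sg P * sm P u := by
      intro u hu
      rcases h.sg_cases with ⟨-, hs, -⟩ | ⟨-, hs, -⟩
      · have h1 := h.sm_anti hu.2 le_rfl
        have h2 : 0 < sm P (qM P) := by rw [h.sm_eq, hs, one_mul]; exact hM
        rw [hs]; linarith
      · have h1 := h.sm_anti hu.1.le hu.2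
        rw [IsFlow.sm_zero, hs] at h1
        rw [hs]; linarith
    have hz := h.zeta_mem h.qM_pos le_rfl (hm _ ⟨h.qM_pos, le_rfl⟩)
    have h0 : Sig P (qM P) = 0 := by
      -- For `u = q_M` the interval `[q_M, 2q_M - u]` containing `ζ(u)` is a single point.
      have : zeta P (qM P) = qM P := le_antisymm (by linarith [hz.2]) hz.1
      rw [Sig, this, intervalIntegral.integral_same, Real.exp_zero, sub_self]
    have hb := h.bijOn_sig h.qM_pos le_rfl hm
    rw [h0] at hb
    exact ⟨fun u hu => h.wellDefinedAt le_rfl hm hu, h.strictAntiOn_sig le_rfl hm,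
      h.continuousOn_sig le_rfl hm, hb, h.tendsto_sig h.qM_pos le_rfl hm, h0⟩
  · intro hM hell
    have h : Good P := ⟨hR, hR1, hb₁, hb₂, hb₃, fun _ => hell⟩
    have hm0 : m P 0 = 1 := by unfold m; ring
    -- For `R > 1` the vertex would be a maximum of `m`, so `m_M ≥ m(0) = 1`.
    have hR1' : P.R < 1 := by
      by_contra! hge
      have h1 := m_eq hR hb₁ (0 : ℝ)
      rw [hm0] at h1
      have h2 : P.R * (1 - P.R) / P.b₁ ≤ 0 :=
        div_nonpos_of_nonpos_of_nonneg (mul_nonpos_of_nonneg_of_nonpos hR.le (by linarith)) hb₁.le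
      linarith [mul_nonpos_of_nonpos_of_nonneg h2 (sq_nonneg (0 - qM P))]
    have hsg := h.sg_eq_one hR1'
    have hsm : ∀ q, sm P q = m P q := fun q => by rw [h.sm_eq, hsg, one_mul]
    have ha : 0 < P.R * (1 - P.R) / P.b₁ := div_pos (mul_pos hR (sub_pos.2 hR1')) hb₁
    set a := P.R * (1 - P.R) / P.b₁ with ha_def
    have hme : ∀ q, m P q = a * (q - qM P) ^ 2 + mM P := m_eq hR hb₁
    set d := √(-mM P / a) with hd
    have hd0 : 0 ≤ d := Real.sqrt_nonneg _
    have hd2 : a * d ^ 2 = -mM P := by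
      rw [hd, Real.sq_sqrt (div_nonneg (by linarith) ha.le)]
      field_simp
    have hroot : ∀ q, m P q = a * ((q - (qM P - d)) * (q - (qM P + d))) := by
      intro q; rw [hme]; linear_combination hd2
    have hqM := h.qM_pos
    -- Otherwise `0` would lie between the roots, contradicting `m(0) = 1`.
    have hpm : 0 < qM P - d := by
      have h1 := hroot 0
      rw [hm0] at h1
      by_contra! hle
      have : 0 ≤ a * ((d - qM P) * (qM P + d)) := by
        have := sub_nonneg.2 (sub_nonpos.1 hle)
        positivity
      linarith
    have hpmM : qM P - d ≤ qM P := by linarith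
    have hmpm : m P (qM P - d) = 0 := by rw [hroot]; ring
    have hm : ∀ u ∈ Ioc 0 (qM P - d), 0 ≤ sg P * sm P u := by
      intro u hu
      have h1 := h.sm_anti hu.2 hpmM
      rw [hsm, hmpm] at h1
      rw [hsg, one_mul]; exact h1
    -- At `ζ(u) ≥ q_M` the value of `m` is that of a nonnegative solution, so `ζ(u)` cannot lie
    -- before the larger root. The mirror bound gives the other side, and the two close up as `u`
    -- tends to the smaller root.
    have hzlb : ∀ u ∈ Ioc 0 (qM P - d), qM P + d ≤ zeta P u ∧ zeta P u ≤ 2 * qM P - u := by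
      intro u hu
      have h1 := hm u hu
      have h2 := h.zeta_mem hu.1 (hu.2.trans hpmM) h1
      rw [hsg, one_mul] at h1
      have h3 := h.sm_zeta_nonneg hR1' hu.1 (hu.2.trans hpmM) h1
      rw [hsm, hroot] at h3
      refine ⟨?_, h2.2⟩
      by_contra! hlt
      rcases hd0.eq_or_lt with hd00 | hdpos
      · linarith [h2.1]
      · have : 0 < a * ((zeta P u - (qM P - d)) * (qM P + d - zeta P u)) := by
          have h4 : 0 < zeta P u - (qM P - d) := by linarith [h2.1]
          have h5 := sub_pos.2 hlt
          positivity
        linarith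
    have hzpm : zeta P (qM P - d) = qM P + d := by
      have := hzlb _ ⟨hpm, le_rfl⟩
      exact le_antisymm (by linarith [this.2]) this.1
    have hle : qM P - d ≤ qM P + d := by linarith
    have hint : EqOn (integrand P (nSol P (qM P - d))) (integrand P (fun _ => 0))
        (uIcc (qM P - d) (qM P + d)) := by
      intro q hq
      rw [uIcc_of_le hle] at hq
      have := h.nSol_eq_zero hR1' hpm hpmM (by rw [hsm, hmpm]) (q := q) (by rwa [hzpm])
      simp only [integrand, this]
    have hxi : Sig P (qM P - d) = xiBar P (qM P - d) (qM P + d) := by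
      rw [Sig, hzpm, xiBar, intervalIntegral.integral_congr hint]
    have hw := fun u hu => h.wellDefinedAt hpmM hm (u := u) hu
    have hcont := h.continuousOn_sig hpmM hm
    have hb := h.bijOn_sig hpm hpmM hm
    rw [hxi] at hb
    refine ⟨qM P - d, qM P + d, hpm, hle, ?_, hw, ?_, ?_, h.strictAntiOn_sig hpmM hm, hcont, hb,
      h.tendsto_sig hpm hpmM hm, hxi,
      fun K ε hε => h.eventually_small hR1' hpm hpmM (by rw [hsm, hmpm]) K hε, ?_⟩
    · ext q
      simp only [mem_ofPred_eq, mem_insert_iff, mem_singleton_iff]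
      rw [hroot, mul_eq_zero, mul_eq_zero, sub_eq_zero, sub_eq_zero]
      simp [ha.ne']
    · have := (hw _ ⟨hpm, le_rfl⟩).integrable
      rw [hzpm] at this
      exact this.congr (hint.mono uIoc_subset_uIcc)
    · have h1 := hcont _ ⟨hpm, le_rfl⟩
      rw [ContinuousWithinAt, hxi] at h1
      refine h1.mono_left (nhdsWithin_le_of_mem ?_)
      filter_upwards [Ioo_mem_nhdsLT hpm] with u hu
      exact ⟨hu.1, hu.2.le⟩
    · have h1 : Tendsto (fun u => 2 * qM P - u) (𝓝[<] (qM P - d)) (𝓝 (qM P + d)) := by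
        have : Tendsto (fun u => 2 * qM P - u) (𝓝 (qM P - d)) (𝓝 (2 * qM P - (qM P - d))) :=
          (continuous_const.sub continuous_id).tendsto _
        rw [show 2 * qM P - (qM P - d) = qM P + d by ring] at this
        exact this.mono_left nhdsWithin_le_nhds
      refine tendsto_of_tendsto_of_tendsto_of_le_of_le' tendsto_const_nhds h1 ?_ ?_ <;>
        filter_upwards [Ioo_mem_nhdsLT hpm] with u hu
      · exact (hzlb u ⟨hu.1, hu.2.le⟩).1
      · exact (hzlb u ⟨hu.1, hu.2.le⟩).2
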